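/- Write $\omega^{+}=\omega$ and $\omega^{-}=\omega^{*}$ (the reverse of $\omega$); for linear orders, $\omega^{\delta}\times L$ denotes the $\omega^{\delta}$-indexed sum of copies of $L$. A \emph{3-signed tree} is a finite ordered rooted tree $T$ with a sign in $\{+,-,0\}$ at each vertex, such that the sign is $0$ exactly at the root and at the leaves. Put $\mathrm{LIN}(T)=\mathbf 0$ if $T$ has only one vertex; otherwise $\mathrm{LIN}(T)$ is computed from the bottom up: a leaf gives $\mathbf 1$, a vertex of sign $\delta\in\{+,-\}$ gives $\omega^{\delta}\times(L_1+\dots+L_n)$, where $L_1,\dots,L_n$ are the orders given by its children in order, and the root gives the sum of the orders given by its children. The \emph{join} $T\curlyvee T'$ identifies the two roots, the children of the root of $T$ coming first; $T$ is a \emph{prefix} and $T'$ a \emph{suffix} of $T\curlyvee T'$, and $\mathrm{LIN}(T\curlyvee T')=\mathrm{LIN}(T)+\mathrm{LIN}(T')$. \emph{L-equivalence} $\approx_L$ is the equivalence relation on 3-signed trees generated by the following moves at a vertex $\sigma$ of sign $\delta\neq 0$ with child subtrees $C_1,\dots,C_n$: \begin{itemize} \item EXUDE, $\delta=+$: replace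 the child subtrees of $\sigma$ by $C_2,\dots,C_n,C_1$ and insert a copy of $C_1$ as a sibling immediately to the left of $\sigma$; \item EXUDE, $\delta=-$: replace the child subtrees of $\sigma$ by $C_n,C_1,\dots,C_{n-1}$ and insert a copy of $C_n$ as a sibling immediately to the right of $\sigma$; \item $m$-REPL, $m\ge 1$: repeat the list $C_1,\dots,C_n$ of child subtrees of $\sigma$ $m$ times. \end{itemize} Each move induces an isomorphism of the associated orders (through the obvious isomorphisms $\omega\times(X+Y)\cong X+\omega\times(Y+X)$, $\omega^{*}\times(Y+X)\cong\omega^{*}\times(X+Y)+X$ and $\omega^{\delta}\times X\cong\omega^{\delta}\times(\mathbf m\times X)$, applied at $\sigma$), so each derivation of an L-equivalence from moves and their inverses induces one by composition. \textbf{Theorem.} Let $T,T'$ be 3-signed trees and let $f:\mathrm{LIN}(T)\to\mathrm{LIN}(T')$ be a prefix (resp. suffix) embedding, that is, an order embedding onto an initial (resp. final) segment. Then there are 3-signed trees $\tilde T\approx_L T$ and $\tilde T'\approx_L T'$ such that $\tilde T$ is a prefix (resp. suffix) of $\tilde T'$ and the following hold. \begin{enumerate} \item There are a derivation of $\tilde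 T'\approx_L T'$, with induced isomorphism $h:\mathrm{LIN}(\tilde T')\to\mathrm{LIN}(T')$, and an isomorphism $g:\mathrm{LIN}(T)\to\mathrm{LIN}(\tilde T)$ such that $h|_{\mathrm{LIN}(\tilde T)}=f g^{-1}$. \item For every isomorphism $g:\mathrm{LIN}(T)\to\mathrm{LIN}(\tilde T)$, in particular for each one induced by a derivation of $T\approx_L\tilde T$, there is an isomorphism $h:\mathrm{LIN}(\tilde T')\to\mathrm{LIN}(T')$ such that $h|_{\mathrm{LIN}(\tilde T)}=f g^{-1}$. \end{enumerate} Here $\mathrm{LIN}(\tilde T)$ is regarded as a prefix (resp. suffix) of $\mathrm{LIN}(\tilde T')$. -/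

import Mathlib

/-! ### Concrete order isomorphisms

`X ⊕ₗ Y` is the sum of the linear orders `X` and `Y`, and `X ×ₗ Y` is the lexicographic product,
that is, the `X`-indexed sum of copies of `Y`; `ℕ` is `ω` and `ℕᵒᵈ` is `ω*`. -/

namespace OrderSum

/-- `ω × (X + Y) → X + ω × (Y + X)`, splitting off the first copy of `X`. -/
def exudePosFun {X Y : Type} (p : ℕ ×ₗ (X ⊕ₗ Y)) : X ⊕ₗ (ℕ ×ₗ (Y ⊕ₗ X)) :=
  match ofLex p with
  | (n, z) =>
    match n, ofLex z with
    | 0, Sum.inl x => toLex (Sum.inl x)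
    | k + 1, Sum.inl x => toLex (Sum.inr (toLex (k, toLex (Sum.inr x))))
    | k, Sum.inr y => toLex (Sum.inr (toLex (k, toLex (Sum.inl y))))

theorem exudePosFun_strictMono {X Y : Type} [LinearOrder X] [LinearOrder Y] :
    StrictMono (exudePosFun (X := X) (Y := Y)) := by
  simp only [StrictMono, Lex.forall]
  rintro ⟨_ | n, z⟩ ⟨_ | m, w⟩ h <;> revert h <;> induction z with | _ z => ?_ <;>
    induction w with | _ w => ?_ <;> rcases z with z | z <;> rcases w with w | w <;>
    simp [exudePosFun, Prod.Lex.toLex_lt_toLex] <;> omega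

theorem exudePosFun_surjective {X Y : Type} :
    Function.Surjective (exudePosFun (X := X) (Y := Y)) := by
  simp only [Function.Surjective, Lex.forall]
  rintro (x | p)
  · exact ⟨toLex (0, toLex (Sum.inl x)), rfl⟩
  · induction p with | _ p => ?_
    obtain ⟨k, z⟩ := p
    induction z with | _ z => ?_
    rcases z with y | x
    · exact ⟨toLex (k, toLex (Sum.inr y)), by cases k <;> rfl⟩
    · exact ⟨toLex (k + 1, toLex (Sum.inl x)), rfl⟩

/-- `ω × (X + Y) ≅ X + ω × (Y + X)`. -/
noncomputable def exudePos (X Y : Type) [LinearOrder X] [LinearOrder Y] :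
    ℕ ×ₗ (X ⊕ₗ Y) ≃o X ⊕ₗ (ℕ ×ₗ (Y ⊕ₗ X)) :=
  StrictMono.orderIsoOfSurjective _ exudePosFun_strictMono exudePosFun_surjective

/-- `ω* × (Y + X) → ω* × (X + Y) + X`, splitting off the last copy of `X`. -/
def exudeNegFun {X Y : Type} (p : ℕᵒᵈ ×ₗ (Y ⊕ₗ X)) : (ℕᵒᵈ ×ₗ (X ⊕ₗ Y)) ⊕ₗ X :=
  match ofLex p with
  | (n, z) =>
    match OrderDual.ofDual n, ofLex z with
    | 0, Sum.inr x => toLex (Sum.inr x)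
    | k + 1, Sum.inr x => toLex (Sum.inl (toLex (OrderDual.toDual k, toLex (Sum.inl x))))
    | k, Sum.inl y => toLex (Sum.inl (toLex (OrderDual.toDual k, toLex (Sum.inr y))))

theorem exudeNegFun_strictMono {X Y : Type} [LinearOrder X] [LinearOrder Y] :
    StrictMono (exudeNegFun (X := X) (Y := Y)) := by
  simp only [StrictMono, Lex.forall]
  rintro ⟨n, z⟩ ⟨m, w⟩ h
  revert h
  induction n using OrderDual.rec with | _ n => ?_
  induction m using OrderDual.rec with | _ m => ?_
  rcases n with _ | n <;> rcases m with _ | m <;> induction z with | _ z => ?_ <;>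
    induction w with | _ w => ?_ <;> rcases z with z | z <;> rcases w with w | w <;>
    simp only [exudeNegFun, ofLex_toLex, OrderDual.ofDual_toDual, Prod.Lex.toLex_lt_toLex,
      OrderDual.toDual_lt_toDual, EmbeddingLike.apply_eq_iff_eq, Sum.Lex.inl_lt_inl_iff,
      Sum.Lex.inr_lt_inr_iff, Sum.Lex.inl_lt_inr, Sum.Lex.not_inr_lt_inl] <;> grind

theorem exudeNegFun_surjective {X Y : Type} :
    Function.Surjective (exudeNegFun (X := X) (Y := Y)) := by
  simp only [Function.Surjective, Lex.forall]
  rintro (p | x)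
  · induction p with | _ p => ?_
    obtain ⟨k, z⟩ := p
    induction k using OrderDual.rec with | _ k => ?_
    induction z with | _ z => ?_
    rcases z with x | y
    · exact ⟨toLex (OrderDual.toDual (k + 1), toLex (Sum.inr x)), rfl⟩
    · exact ⟨toLex (OrderDual.toDual k, toLex (Sum.inl y)), by cases k <;> rfl⟩
  · exact ⟨toLex (OrderDual.toDual 0, toLex (Sum.inr x)), rfl⟩

/-- `ω* × (Y + X) ≅ ω* × (X + Y) + X`. -/
noncomputable def exudeNeg (X Y : Type) [LinearOrder X] [LinearOrder Y] :
    ℕᵒᵈ ×ₗ (Y ⊕ₗ X) ≃o (ℕᵒᵈ ×ₗ (X ⊕ₗ Y)) ⊕ₗ X :=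
  StrictMono.orderIsoOfSurjective _ exudeNegFun_strictMono exudeNegFun_surjective

/-- `X + m × X → (m + 1) × X`. -/
def consFinFun {X : Type} {m : ℕ} (p : X ⊕ₗ (Fin m ×ₗ X)) : Fin (m + 1) ×ₗ X :=
  match ofLex p with
  | Sum.inl x => toLex (0, x)
  | Sum.inr q => toLex ((ofLex q).1.succ, (ofLex q).2)

theorem consFinFun_strictMono {X : Type} [LinearOrder X] {m : ℕ} :
    StrictMono (consFinFun (X := X) (m := m)) := by
  simp only [StrictMono, Lex.forall]
  rintro (x | p) (y | q) <;> try induction p with | _ p => ?_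
  all_goals try induction q with | _ q => ?_
  all_goals simp [consFinFun, Prod.Lex.toLex_lt_toLex]

theorem consFinFun_surjective {X : Type} {m : ℕ} :
    Function.Surjective (consFinFun (X := X) (m := m)) := by
  simp only [Function.Surjective, Lex.forall]
  rintro ⟨i, x⟩
  refine Fin.cases ?_ (fun j => ?_) i
  · exact ⟨toLex (Sum.inl x), rfl⟩
  · exact ⟨toLex (Sum.inr (toLex (j, x))), rfl⟩

/-- `X + m × X ≅ (m + 1) × X`. -/
noncomputable def consFin (X : Type) [LinearOrder X] (m : ℕ) :
    X ⊕ₗ (Fin m ×ₗ X) ≃o Fin (m + 1) ×ₗ X :=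
  StrictMono.orderIsoOfSurjective _ consFinFun_strictMono consFinFun_surjective

/-- `ω × m ≅ ω` for `m > 0`: the `j`-th point of the `n`-th block goes to `n * m + j`. -/
def blockPosFun (m : ℕ) (p : ℕ ×ₗ Fin m) : ℕ := (ofLex p).1 * m + (ofLex p).2

theorem blockPosFun_strictMono (m : ℕ) : StrictMono (blockPosFun m) := by
  simp only [StrictMono, Lex.forall]
  rintro ⟨n, i⟩ ⟨k, j⟩ h
  rw [Prod.Lex.toLex_lt_toLex] at h
  simp only [blockPosFun, ofLex_toLex]
  rcases h with h | ⟨h, h'⟩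
  · have : (n + 1) * m ≤ k * m := Nat.mul_le_mul_right m h
    have := i.2
    simp only at *
    nlinarith
  · simp only at h h'
    subst h
    simpa using h'

theorem blockPosFun_surjective (m : ℕ) [NeZero m] : Function.Surjective (blockPosFun m) :=
  fun a => ⟨toLex (a / m, ⟨a % m, Nat.mod_lt _ (Nat.pos_of_neZero m)⟩),
    by simpa [blockPosFun, mul_comm] using Nat.div_add_mod a m⟩

/-- `ω × m ≅ ω` for `m > 0`. -/
noncomputable def blockPos (m : ℕ) [NeZero m] : ℕ ×ₗ Fin m ≃o ℕ :=
  StrictMono.orderIsoOfSurjective _ (blockPosFun_strictMono m) (blockPosFun_surjective m)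

/-- `ω* × m ≅ ω*` for `m > 0`, the mirror image of `blockPosFun`. -/
def blockNegFun (m : ℕ) (p : ℕᵒᵈ ×ₗ Fin m) : ℕᵒᵈ :=
  OrderDual.toDual (blockPosFun m (toLex (OrderDual.ofDual (ofLex p).1, (ofLex p).2.rev)))

theorem blockNegFun_strictMono (m : ℕ) : StrictMono (blockNegFun m) := by
  simp only [StrictMono, Lex.forall]
  rintro ⟨n, i⟩ ⟨k, j⟩ h
  rw [Prod.Lex.toLex_lt_toLex] at h
  refine OrderDual.toDual_lt_toDual.2 (blockPosFun_strictMono m ?_)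
  rw [Prod.Lex.toLex_lt_toLex]
  rcases h with h | ⟨h, h'⟩
  · exact Or.inl h
  · exact Or.inr ⟨congrArg OrderDual.ofDual h.symm, Fin.rev_lt_rev.2 h'⟩

theorem blockNegFun_surjective (m : ℕ) [NeZero m] : Function.Surjective (blockNegFun m) := by
  intro a
  obtain ⟨p, hp⟩ := blockPosFun_surjective m (OrderDual.ofDual a)
  refine ⟨toLex (OrderDual.toDual (ofLex p).1, (ofLex p).2.rev), ?_⟩
  simp only [blockNegFun, ofLex_toLex, Fin.rev_rev, OrderDual.ofDual_toDual]
  exact congrArg OrderDual.toDual hp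

/-- `ω* × m ≅ ω*` for `m > 0`. -/
noncomputable def blockNeg (m : ℕ) [NeZero m] : ℕᵒᵈ ×ₗ Fin m ≃o ℕᵒᵈ :=
  StrictMono.orderIsoOfSurjective _ (blockNegFun_strictMono m) (blockNegFun_surjective m)

end OrderSum

/-! ### 3-signed trees -/

/-- The two nonzero signs. -/
inductive Sign3 : Type
  | pos : Sign3
  | neg : Sign3

/-- A finite ordered tree hanging below the root of a 3-signed tree: either a leaf (of sign `0`),
or a vertex of nonzero sign `s` with the nonempty list `c :: cs` of child subtrees. -/
inductive Vertex : Type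
  | leaf : Vertex
  | node (s : Sign3) (c : Vertex) (cs : List Vertex) : Vertex

/-- A 3-signed tree: the root has sign `0` and is given by the list of its child subtrees (in the
standard labelling, the child `x` of the root is the `x`-th entry of the list). The sign of a
vertex is `0` exactly at the root and at the leaves. -/
abbrev ThreeST : Type := List Vertex

/-- The vertex of sign `s` whose child subtrees are given by the nonempty list `l`. -/
def Vertex.ofChildren (s : Sign3) : (l : List Vertex) → l ≠ [] → Vertex
  | [], h => absurd rfl h
  | c :: cs, _ => Vertex.node s c cs

/-- The join `T ⋎ T'`: identify the roots, the children of the root of `T` coming first. -/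
abbrev ThreeST.join (T T' : ThreeST) : ThreeST := T ++ T'

/-- `ω⁺ = ω` and `ω⁻ = ω*`. -/
def Sign3.omega : Sign3 → LinOrd.{0}
  | .pos => LinOrd.of ℕ
  | .neg => LinOrd.of ℕᵒᵈ

mutual

/-- The linear order attached to a non-root vertex: `1` at a leaf, and `ω^s × (sum over the
children)` at a vertex of sign `s`. -/
def Vertex.LIN : Vertex → LinOrd.{0}
  | .leaf => LinOrd.of PUnit
  | .node s c cs => LinOrd.of (s.omega ×ₗ (c.LIN ⊕ₗ ThreeST.LIN cs))

/-- The linear order `LIN(T)` of a 3-signed tree: the sum over the children of the root, `0` if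
the root is the only vertex. -/
def ThreeST.LIN : List Vertex → LinOrd.{0}
  | [] => LinOrd.of PEmpty
  | v :: vs => LinOrd.of (v.LIN ⊕ₗ ThreeST.LIN vs)

end

namespace ThreeST

/-! ### L-equivalence -/

/-- One basic move on 3-signed trees. The constructors `exudePos`, `exudeNeg` and `repl` are the
moves `EXUDE` and `m`-`REPL` at a vertex `σ`, written for the subtree at `σ`; `sibling` and `under`
put them in place at an arbitrary non-root non-leaf vertex of a 3-signed tree. -/
inductive Move : ThreeST → ThreeST → Type
  /-- `EXUDE` at a `+` vertex: the first child moves out, to the immediate left of the vertex, and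
  a copy of it becomes the last child. -/
  | exudePos (c : Vertex) (cs : List Vertex) :
      Move [.ofChildren .pos (c :: cs) (by simp)] [c, .ofChildren .pos (cs ++ [c]) (by simp)]
  /-- `EXUDE` at a `-` vertex: the last child moves out, to the immediate right of the vertex, and
  a copy of it becomes the first child. -/
  | exudeNeg (cs : List Vertex) (c : Vertex) :
      Move [.ofChildren .neg (cs ++ [c]) (by simp)] [.ofChildren .neg (c :: cs) (by simp), c]
  /-- `m`-`REPL`: the list of children is repeated `m ≥ 1` times. -/
  | repl (m : ℕ) [NeZero m] (s : Sign3) (l : List Vertex) (h : l ≠ [])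
      (h' : (List.replicate m l).flatten ≠ []) :
      Move [.ofChildren s l h] [.ofChildren s (List.replicate m l).flatten h']
  /-- a move among siblings, with further siblings `A` to the left and `B` to the right -/
  | sibling (A B : List Vertex) {F F' : List Vertex} (e : Move F F') :
      Move (A ++ F ++ B) (A ++ F' ++ B)
  /-- a move below a vertex of sign `s` -/
  | under (s : Sign3) {F F' : List Vertex} (h : F ≠ []) (h' : F' ≠ []) (e : Move F F') :
      Move [.ofChildren s F h] [.ofChildren s F' h']

/-- L-equivalence of 3-signed trees: the equivalence relation generated by the basic moves. -/
def LEquiv (T T' : ThreeST) : Prop :=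
  Relation.EqvGen (fun A B : ThreeST => Nonempty (Move A B)) T T'

/-- A derivation of an L-equivalence from basic moves. -/
inductive Deriv : ThreeST → ThreeST → Type
  | move {T T' : ThreeST} (e : Move T T') : Deriv T T'
  | refl (T : ThreeST) : Deriv T T
  | symm {T T' : ThreeST} (d : Deriv T T') : Deriv T' T
  | trans {T T' T'' : ThreeST} (d : Deriv T T') (d' : Deriv T' T'') : Deriv T T''

theorem lEquiv_iff_nonempty_deriv {T T' : ThreeST} : LEquiv T T' ↔ Nonempty (Deriv T T') := by
  constructor
  · intro h
    induction h with
    | rel _ _ h => exact h.map Deriv.move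
    | refl _ => exact ⟨Deriv.refl _⟩
    | symm _ _ _ ih => exact ih.map Deriv.symm
    | trans _ _ _ _ _ ih ih' => exact ⟨ih.some.trans ih'.some⟩
  · rintro ⟨d⟩
    induction d with
    | move e => exact .rel _ _ ⟨e⟩
    | refl T => exact .refl _
    | symm d ih => exact .symm _ _ ih
    | trans d d' ih ih' => exact .trans _ _ _ ih ih'

/-! ### The isomorphisms induced by L-equivalences -/

/-- `LIN(A ⋎ B) ≅ LIN(A) + LIN(B)`. -/
def appendIso : (A B : List Vertex) → LIN (A ++ B) ≃o LIN A ⊕ₗ LIN B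
  | [], B => (OrderIso.emptySumLex (α := LIN B) (β := PEmpty)).symm
  | v :: A, B =>
    ((OrderIso.refl v.LIN).sumLexCongr (appendIso A B)).trans
      (OrderIso.sumLexAssoc v.LIN (LIN A) (LIN B)).symm

/-- `LIN` of a tree with one branch at the root. -/
def singletonIso (v : Vertex) : LIN [v] ≃o v.LIN :=
  OrderIso.sumLexEmpty (α := v.LIN) (β := PEmpty)

/-- The defining formula of `LIN` at a vertex of nonzero sign. -/
def ofChildrenIso (s : Sign3) : (l : List Vertex) → (h : l ≠ []) →
    (Vertex.ofChildren s l h).LIN ≃o s.omega ×ₗ LIN l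
  | [], h => absurd rfl h
  | _ :: _, _ => OrderIso.refl _

/-- `LIN` of a tree with a single branch of sign `s` at the root. -/
def branchIso (s : Sign3) (l : List Vertex) (h : l ≠ []) :
    LIN [.ofChildren s l h] ≃o s.omega ×ₗ LIN l :=
  (singletonIso _).trans (ofChildrenIso s l h)

/-- `LIN` of the children repeated `m` times. -/
noncomputable def replicateIso (l : List Vertex) :
    (m : ℕ) → LIN (List.replicate m l).flatten ≃o Fin m ×ₗ LIN l
  | 0 =>
    { toFun := fun x : PEmpty => x.elim
      invFun := fun p => (ofLex p).1.elim0
      left_inv := fun x : PEmpty => x.elim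
      right_inv := fun p => (ofLex p).1.elim0
      map_rel_iff' := fun {x : PEmpty} => x.elim }
  | m + 1 =>
    (appendIso l (List.replicate m l).flatten).trans
      (((OrderIso.refl (LIN l)).sumLexCongr (replicateIso l m)).trans
        (OrderSum.consFin (LIN l) m))

/-- `ω^s × m ≅ ω^s`. -/
noncomputable def blockIso (m : ℕ) [NeZero m] : (s : Sign3) → s.omega ×ₗ Fin m ≃o s.omega
  | .pos => OrderSum.blockPos m
  | .neg => OrderSum.blockNeg m

/-- The isomorphism induced by a basic move: `ω × (X + Y) ≅ X + ω × (Y + X)` and its mirror image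
for `EXUDE`, and `ω^s × X ≅ ω^s × (m × X)` for `REPL`, applied at the vertex in question. -/
noncomputable def Move.iso : {T T' : ThreeST} → Move T T' → (LIN T ≃o LIN T')
  | _, _, .exudePos c cs =>
    (branchIso .pos (c :: cs) (by simp)).trans <|
      (OrderSum.exudePos c.LIN (LIN cs)).trans <|
        (OrderIso.refl c.LIN).sumLexCongr <|
          ((Prod.Lex.prodLexCongr (OrderIso.refl ℕ)
            ((appendIso cs [c]).trans
              ((OrderIso.refl (LIN cs)).sumLexCongr (singletonIso c)))).symm).trans
            (branchIso .pos (cs ++ [c]) (by simp)).symm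
  | _, _, .exudeNeg cs c =>
    (branchIso .neg (cs ++ [c]) (by simp)).trans <|
      (Prod.Lex.prodLexCongr (OrderIso.refl ℕᵒᵈ)
        ((appendIso cs [c]).trans
          ((OrderIso.refl (LIN cs)).sumLexCongr (singletonIso c)))).trans <|
        (OrderSum.exudeNeg c.LIN (LIN cs)).trans <|
          (ofChildrenIso .neg (c :: cs) (by simp)).symm.sumLexCongr (singletonIso c).symm
  | _, _, @Move.repl m _ s l h h' =>
    (branchIso s l h).trans <|
      (Prod.Lex.prodLexCongr (blockIso m s) (OrderIso.refl (LIN l))).symm.trans <|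
        (Prod.Lex.prodLexAssoc s.omega (Fin m) (LIN l)).trans <|
          (Prod.Lex.prodLexCongr (OrderIso.refl s.omega) (replicateIso l m)).symm.trans
            (branchIso s _ h').symm
  | _, _, .sibling A B (F := F) (F' := F') e =>
    (appendIso (A ++ F) B).trans <|
      (((appendIso A F).trans
        (((OrderIso.refl (LIN A)).sumLexCongr e.iso).trans (appendIso A F').symm)).sumLexCongr
          (OrderIso.refl (LIN B))).trans
        (appendIso (A ++ F') B).symm
  | _, _, .under s (F := F) (F' := F') h h' e =>
    (branchIso s F h).trans <|
      (Prod.Lex.prodLexCongr (OrderIso.refl s.omega) e.iso).trans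
        (branchIso s F' h').symm

/-- The isomorphism induced by a derivation of an L-equivalence. -/
noncomputable def Deriv.iso : {T T' : ThreeST} → Deriv T T' → (LIN T ≃o LIN T')
  | _, _, .move e => e.iso
  | _, _, .refl _ => OrderIso.refl _
  | _, _, .symm d => d.iso.symm
  | _, _, .trans d d' => d.iso.trans d'.iso

/-- The inclusion of `LIN(T)` in `LIN(T ⋎ R)` as a prefix. -/
def prefixIncl (T R : ThreeST) (x : LIN T) : LIN (T.join R) :=
  (appendIso T R).symm (toLex (Sum.inl x))

/-- The inclusion of `LIN(T)` in `LIN(R ⋎ T)` as a suffix. -/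
def suffixIncl (R T : ThreeST) (x : LIN T) : LIN (R.join T) :=
  (appendIso R T).symm (toLex (Sum.inr x))

/-- A prefix embedding: an order embedding onto an initial segment. -/
def IsPrefixEmbedding {L L' : Type} [LinearOrder L] [LinearOrder L'] (f : L ↪o L') : Prop :=
  IsLowerSet (Set.range f)

/-- A suffix embedding: an order embedding onto a final segment. -/
def IsSuffixEmbedding {L L' : Type} [LinearOrder L] [LinearOrder L'] (f : L ↪o L') : Prop :=
  IsUpperSet (Set.range f)

end ThreeST

/-!
Two facts carry the proof.

Cutting (`exists_deriv_append`): every initial segment `I` of `LIN(T)` is, up to a derivation, the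
order of a prefix. By induction on the tree it suffices to cut at a vertex of nonzero sign. At a `+`
vertex an initial segment that omits some point is bounded by finitely many copies of the children,
and exuding children one at a time moves the omitted point to the front until the cut falls into an
exuded child. At a `-` vertex one exudes to the right, following a point of `I`.

Completeness (`lEquiv_of_iso`): trees with isomorphic orders are L-equivalent. The depth of a tree
is monotone under embeddings of orders (`depth_le_of_embedding`), and the proof is by induction on it.
Cutting reduces the claim to an isomorphism from the order of a single vertex to `LIN(A)`, and
reversal to a vertex of sign `+` with list of children `l`, that is, to `ω × l ≅ LIN(A)`, where
`ω × l` is short for `ω × LIN(l)`. Comparing depths, `A` has the form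
`S + ω × l'` with `l'` no deeper than `l` (`exists_eq_ofChildren_pos`). Let `r` be the depth of `l`,
and call an interval small if it embeds into the order of a tree of depth less than `r`. Next to a
child of depth `r` there is a cut of `ω × l`, recurring in every period, across which no interval is
small, while intervals inside a single child of `l'` are small; so the isomorphism maps these cuts
to cuts between children of `l'`. Since `l'` has finitely many children, two of the cuts land at the
same place of the period. The heads before the first of them and the segments between the two are
isomorphic and of depth at most `r`, hence L-equivalent by induction, and `EXUDE` and `REPL`
reassemble both sides from head and segment (`lEquiv_of_iso_pos_append`).

Given a prefix embedding `f : LIN(T) → LIN(T')`, cutting `LIN(T')` along the range of `f` gives a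
derivation of `T' ≈ U ⋎ R` with `LIN(U) ≅ LIN(T)` through `f`, and completeness gives `T ≈ U`. Any
other isomorphism `LIN(T) ≅ LIN(U)` differs from this one by an automorphism of `LIN(U)`, which
extends to `LIN(U ⋎ R)` by the identity of `LIN(R)`. Suffix embeddings are treated by cutting along
the complement of the range.
-/

namespace ThreeST

/-! ### Points of the orders `LIN(T)` -/

/-- A point of the first branch, as a point of the whole tree. -/
def headIn (v : Vertex) (A : List Vertex) (a : v.LIN) : LIN (v :: A) :=
  (toLex (Sum.inl a) : v.LIN ⊕ₗ LIN A)

/-- A point of the remaining branches, as a point of the whole tree. -/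
def tailIn (v : Vertex) (A : List Vertex) (b : LIN A) : LIN (v :: A) :=
  (toLex (Sum.inr b) : v.LIN ⊕ₗ LIN A)

/-- The point `x` of the `n`-th copy of `LIN l` in the order given by a vertex of sign `s` with
children `l`. -/
def copyIn (s : Sign3) (l : List Vertex) (h : l ≠ []) (n : s.omega) (x : LIN l) :
    LIN [.ofChildren s l h] :=
  (branchIso s l h).symm (toLex (n, x))

theorem lin_cons_cases {v : Vertex} {A : List Vertex} (x : LIN (v :: A)) :
    (∃ a, x = headIn v A a) ∨ ∃ b, x = tailIn v A b := by
  rcases (x : v.LIN ⊕ₗ LIN A) with a | b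
  · exact Or.inl ⟨a, rfl⟩
  · exact Or.inr ⟨b, rfl⟩

@[simp] theorem tailIn_le_tailIn {v : Vertex} {A : List Vertex} {a b : LIN A} :
    tailIn v A a ≤ tailIn v A b ↔ a ≤ b := Sum.Lex.inr_le_inr_iff

theorem headIn_lt_tailIn {v : Vertex} {A : List Vertex} (a : v.LIN) (b : LIN A) :
    headIn v A a < tailIn v A b := Sum.Lex.inl_lt_inr _ _

theorem exists_copyIn {s : Sign3} {l : List Vertex} {h : l ≠ []} (x : LIN [.ofChildren s l h]) :
    ∃ n y, x = copyIn s l h n y := by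
  obtain ⟨p, rfl⟩ := (branchIso s l h).symm.surjective x
  exact ⟨(ofLex p).1, (ofLex p).2, rfl⟩

theorem exists_prefixIncl_or {A B : List Vertex} (x : LIN (A ++ B)) :
    (∃ a, x = prefixIncl A B a) ∨ ∃ b, x = suffixIncl A B b := by
  obtain ⟨p, rfl⟩ := (appendIso A B).symm.surjective x
  rcases p with a | b
  · exact Or.inl ⟨a, rfl⟩
  · exact Or.inr ⟨b, rfl⟩

@[simp] theorem appendIso_prefixIncl (A B : ThreeST) (x : LIN A) :
    appendIso A B (prefixIncl A B x) = toLex (Sum.inl x) :=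
  (appendIso A B).apply_symm_apply _

@[simp] theorem appendIso_suffixIncl (A B : ThreeST) (x : LIN B) :
    appendIso A B (suffixIncl A B x) = toLex (Sum.inr x) :=
  (appendIso A B).apply_symm_apply _

theorem prefixIncl_cons_tailIn (v : Vertex) (A B : List Vertex) (a : LIN A) :
    prefixIncl (v :: A) B (tailIn v A a) = tailIn v (A ++ B) (prefixIncl A B a) := rfl

theorem suffixIncl_cons (v : Vertex) (A B : List Vertex) (b : LIN B) :
    suffixIncl (v :: A) B b = tailIn v (A ++ B) (suffixIncl A B b) := rfl

theorem suffixIncl_nil (B : List Vertex) (b : LIN B) : suffixIncl [] B b = b := rfl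

/-- The index of the branch at the root on which a point of `LIN(T)` lies. -/
def branchIdx : (A : List Vertex) → LIN A → ℕ
  | [], _ => 0
  | v :: A, x => match ofLex (x : v.LIN ⊕ₗ LIN A) with
    | Sum.inl _ => 0
    | Sum.inr y => branchIdx A y + 1

@[simp] theorem branchIdx_headIn (v : Vertex) (A : List Vertex) (a : v.LIN) :
    branchIdx (v :: A) (headIn v A a) = 0 := rfl

@[simp] theorem branchIdx_tailIn (v : Vertex) (A : List Vertex) (b : LIN A) :
    branchIdx (v :: A) (tailIn v A b) = branchIdx A b + 1 := rfl

theorem branchIdx_lt : ∀ {A : List Vertex} (x : LIN A), branchIdx A x < A.length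
  | [], x => (x : PEmpty).elim
  | v :: A, x => by
    rcases lin_cons_cases x with ⟨a, rfl⟩ | ⟨b, rfl⟩
    · simp
    · simpa using branchIdx_lt b

theorem branchIdx_mono : ∀ (A : List Vertex), Monotone (branchIdx A)
  | [], x => (x : PEmpty).elim
  | v :: A, x => by
    intro y h
    rcases lin_cons_cases x with ⟨a, rfl⟩ | ⟨a, rfl⟩ <;>
      rcases lin_cons_cases y with ⟨b, rfl⟩ | ⟨b, rfl⟩
    · simp
    · simp
    · exact absurd h (not_le.2 (headIn_lt_tailIn b a))
    · simpa using branchIdx_mono A (tailIn_le_tailIn.1 h)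

@[simp] theorem branchIdx_prefixIncl : ∀ (A B : List Vertex) (x : LIN A),
    branchIdx (A ++ B) (prefixIncl A B x) = branchIdx A x
  | [], _, x => (x : PEmpty).elim
  | v :: A, B, x => by
    rcases lin_cons_cases x with ⟨a, rfl⟩ | ⟨b, rfl⟩
    · rfl
    · have := branchIdx_prefixIncl A B b
      simpa [prefixIncl_cons_tailIn] using this

@[simp] theorem branchIdx_suffixIncl : ∀ (A B : List Vertex) (x : LIN B),
    branchIdx (A ++ B) (suffixIncl A B x) = A.length + branchIdx B x
  | [], B, x => by simp [suffixIncl_nil]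
  | v :: A, B, x => by
    have := branchIdx_suffixIncl A B x
    simp only [List.cons_append, suffixIncl_cons, branchIdx_tailIn, this, List.length_cons]
    omega

/-! ### The effect of the moves on points -/

theorem exudePos_iso_tailIn (c : Vertex) (cs : List Vertex) (n : ℕ) (y : LIN cs) :
    (Move.exudePos c cs).iso (copyIn .pos (c :: cs) (by simp) n (tailIn c cs y)) =
      tailIn c _ (copyIn .pos (cs ++ [c]) (by simp) n (prefixIncl cs [c] y)) := by
  cases n <;> rfl

theorem exudePos_iso_headIn_zero (c : Vertex) (cs : List Vertex) (x : c.LIN) :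
    (Move.exudePos c cs).iso (copyIn .pos (c :: cs) (by simp) (0 : ℕ) (headIn c cs x)) =
      headIn c _ x := rfl

theorem exudePos_iso_headIn_succ (c : Vertex) (cs : List Vertex) (n : ℕ) (x : c.LIN) :
    (Move.exudePos c cs).iso (copyIn .pos (c :: cs) (by simp) (n + 1 : ℕ) (headIn c cs x)) =
      tailIn c _ (copyIn .pos (cs ++ [c]) (by simp) n (suffixIncl cs [c] (headIn c [] x))) := rfl

theorem branchIso_copyIn (s : Sign3) (l : List Vertex) (h : l ≠ []) (n : s.omega) (x : LIN l) :
    branchIso s l h (copyIn s l h n x) = toLex (n, x) :=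
  (branchIso s l h).apply_symm_apply _

theorem exudeNeg_iso_copyIn (c : Vertex) (cs : List Vertex) (n : ℕᵒᵈ) (z : LIN (cs ++ [c])) :
    (Move.exudeNeg cs c).iso (copyIn .neg (cs ++ [c]) (by simp) n z) =
      ((ofChildrenIso .neg (c :: cs) (by simp)).symm.sumLexCongr (singletonIso c).symm)
        (OrderSum.exudeNegFun (toLex (n, ((OrderIso.refl (LIN cs)).sumLexCongr (singletonIso c))
          (appendIso cs [c] z)))) := by
  have := congrArg (fun p : ℕᵒᵈ ×ₗ LIN (cs ++ [c]) =>
    ((ofChildrenIso .neg (c :: cs) (by simp)).symm.sumLexCongr (singletonIso c).symm)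
        (OrderSum.exudeNegFun (toLex ((ofLex p).1,
          ((OrderIso.refl (LIN cs)).sumLexCongr (singletonIso c))
          (appendIso cs [c] (ofLex p).2)))))
    (branchIso_copyIn .neg (cs ++ [c]) (by simp) n z)
  exact this

theorem exudeNeg_iso_prefixIncl (c : Vertex) (cs : List Vertex) (n : ℕ) (y : LIN cs) :
    (Move.exudeNeg cs c).iso
        (copyIn .neg (cs ++ [c]) (by simp) (OrderDual.toDual n) (prefixIncl cs [c] y)) =
      prefixIncl [Vertex.ofChildren .neg (c :: cs) (by simp)] [c]
        (copyIn .neg (c :: cs) (by simp) (OrderDual.toDual n) (tailIn c cs y)) := by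
  refine (exudeNeg_iso_copyIn c cs _ _).trans ?_
  refine (congrArg (fun p => ((ofChildrenIso .neg (c :: cs) (by simp)).symm.sumLexCongr
    (singletonIso c).symm) (OrderSum.exudeNegFun (toLex (OrderDual.toDual n,
      ((OrderIso.refl (LIN cs)).sumLexCongr (singletonIso c)) p))))
    (appendIso_prefixIncl cs [c] y)).trans ?_
  cases n <;> rfl

theorem exudeNeg_iso_suffixIncl_zero (c : Vertex) (cs : List Vertex) (x : LIN [c]) :
    (Move.exudeNeg cs c).iso
        (copyIn .neg (cs ++ [c]) (by simp) (OrderDual.toDual (0 : ℕ)) (suffixIncl cs [c] x)) =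
      suffixIncl [Vertex.ofChildren .neg (c :: cs) (by simp)] [c] x := by
  refine (exudeNeg_iso_copyIn c cs _ _).trans ?_
  refine (congrArg (fun p => ((ofChildrenIso .neg (c :: cs) (by simp)).symm.sumLexCongr
    (singletonIso c).symm) (OrderSum.exudeNegFun (toLex (OrderDual.toDual 0,
      ((OrderIso.refl (LIN cs)).sumLexCongr (singletonIso c)) p))))
    (appendIso_suffixIncl cs [c] x)).trans ?_
  obtain ⟨a, rfl⟩ := (singletonIso c).symm.surjective x
  rfl

theorem exudeNeg_iso_suffixIncl_succ (c : Vertex) (cs : List Vertex) (n : ℕ) (x : c.LIN) :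
    (Move.exudeNeg cs c).iso
        (copyIn .neg (cs ++ [c]) (by simp) (OrderDual.toDual (n + 1 : ℕ))
          (suffixIncl cs [c] (headIn c [] x))) =
      prefixIncl [Vertex.ofChildren .neg (c :: cs) (by simp)] [c]
        (copyIn .neg (c :: cs) (by simp) (OrderDual.toDual n) (headIn c cs x)) := by
  refine (exudeNeg_iso_copyIn c cs _ _).trans ?_
  exact congrArg (fun p => ((ofChildrenIso .neg (c :: cs) (by simp)).symm.sumLexCongr
    (singletonIso c).symm) (OrderSum.exudeNegFun (toLex (OrderDual.toDual (n + 1),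
      ((OrderIso.refl (LIN cs)).sumLexCongr (singletonIso c)) p))))
    (appendIso_suffixIncl cs [c] (headIn c [] x))

/-! ### Derivations in context -/

theorem Deriv.exists_append (B : List Vertex) {F F' : ThreeST} (d : Deriv F F') :
    ∃ d' : Deriv (F ++ B) (F' ++ B),
      (∀ x, d'.iso (prefixIncl F B x) = prefixIncl F' B (d.iso x)) ∧
      ∀ y, d'.iso (suffixIncl F B y) = suffixIncl F' B y := by
  induction d with
  | @move F F' e =>
    refine ⟨.move (.sibling [] B e), fun x => ?_, fun y => ?_⟩
    · have := congrArg (fun p : LIN F ⊕ₗ LIN B => (appendIso F' B).symm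
        (e.iso.sumLexCongr (OrderIso.refl (LIN B)) p)) (appendIso_prefixIncl F B x)
      exact this
    · have := congrArg (fun p : LIN F ⊕ₗ LIN B => (appendIso F' B).symm
        (e.iso.sumLexCongr (OrderIso.refl (LIN B)) p)) (appendIso_suffixIncl F B y)
      exact this
  | refl T => exact ⟨.refl _, fun _ => rfl, fun _ => rfl⟩
  | symm d ih =>
    obtain ⟨d', h, h'⟩ := ih
    refine ⟨.symm d', fun x => ?_, fun y => ?_⟩
    · change d'.iso.symm _ = prefixIncl _ _ (d.iso.symm x)
      rw [OrderIso.symm_apply_eq, h, OrderIso.apply_symm_apply]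
    · change d'.iso.symm _ = _
      rw [OrderIso.symm_apply_eq, h']
  | trans d e ih ih' =>
    obtain ⟨d', h, h'⟩ := ih
    obtain ⟨e', k, k'⟩ := ih'
    refine ⟨.trans d' e', fun x => ?_, fun y => ?_⟩
    · change e'.iso (d'.iso _) = _
      rw [h, k]; rfl
    · change e'.iso (d'.iso _) = _
      rw [h', k']

/-- The identification of `LIN(T)` and `LIN(T')` for equal trees. -/
def eqIso {T T' : ThreeST} (h : T = T') : LIN T ≃o LIN T' := h ▸ OrderIso.refl _

theorem eqIso_headIn {v : Vertex} {A A' : List Vertex} (h : A = A') (h' : v :: A = v :: A')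
    (a : v.LIN) : eqIso h' (headIn v A a) = headIn v A' a := by subst h; rfl

theorem eqIso_tailIn {v : Vertex} {A A' : List Vertex} (h : A = A') (h' : v :: A = v :: A')
    (b : LIN A) : eqIso h' (tailIn v A b) = tailIn v A' (eqIso h b) := by subst h; rfl

theorem eqIso_prefixIncl_nil : ∀ {A : List Vertex} (h : A ++ [] = A) (x : LIN A),
    eqIso h (prefixIncl A [] x) = x
  | [], _, x => (x : PEmpty).elim
  | v :: A, h, x => by
    rcases lin_cons_cases x with ⟨a, rfl⟩ | ⟨b, rfl⟩
    · exact eqIso_headIn (List.append_nil A) h a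
    · exact (eqIso_tailIn (List.append_nil A) h _).trans
        (congrArg (tailIn v A) (eqIso_prefixIncl_nil _ b))

theorem Deriv.exists_of_eq {T T' : ThreeST} (h : T = T') : ∃ d : Deriv T T', d.iso = eqIso h := by
  subst h; exact ⟨.refl _, rfl⟩

/-- The isomorphism `LIN(v :: F) ≅ LIN(v :: F')` that acts as `e` on the branches after `v`. -/
def consCongr (v : Vertex) {F F' : List Vertex} (e : LIN F ≃o LIN F') :
    LIN (v :: F) ≃o LIN (v :: F') :=
  ((OrderIso.refl v.LIN).sumLexCongr e : v.LIN ⊕ₗ LIN F ≃o v.LIN ⊕ₗ LIN F')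

theorem Deriv.exists_cons (v : Vertex) {F F' : ThreeST} (d : Deriv F F') :
    ∃ d' : Deriv (v :: F) (v :: F'),
      (∀ a, d'.iso (headIn v F a) = headIn v F' a) ∧
      ∀ b, d'.iso (tailIn v F b) = tailIn v F' (d.iso b) := by
  induction d with
  | @move F F' e =>
    obtain ⟨d₁, h₁⟩ := Deriv.exists_of_eq (List.append_nil (v :: F))
    obtain ⟨d₂, h₂⟩ := Deriv.exists_of_eq (List.append_nil (v :: F'))
    let e' : Move ((v :: F) ++ []) ((v :: F') ++ []) := .sibling [v] [] e
    let G : LIN (v :: F) ≃o LIN (v :: F') := (appendIso [v] F).trans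
        (((OrderIso.refl (LIN [v])).sumLexCongr e.iso).trans (appendIso [v] F').symm)
    have hG : ∀ x, G x = consCongr v e.iso x := by
      intro x
      rcases lin_cons_cases x with ⟨a, rfl⟩ | ⟨b, rfl⟩ <;> rfl
    have key : ∀ x, e'.iso (prefixIncl (v :: F) [] x) =
        prefixIncl (v :: F') [] (consCongr v e.iso x) := by
      intro x
      have := congrArg (fun p : LIN (v :: F) ⊕ₗ LIN [] => (appendIso (v :: F') []).symm
        (G.sumLexCongr (OrderIso.refl (LIN [])) p)) (appendIso_prefixIncl (v :: F) [] x)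
      rw [← hG]
      exact this
    have key' : ∀ x, (d₁.symm.trans ((Deriv.move e').trans d₂)).iso x = consCongr v e.iso x := by
      intro x
      change d₂.iso (e'.iso (d₁.iso.symm x)) = _
      have : d₁.iso.symm x = prefixIncl (v :: F) [] x := by
        rw [OrderIso.symm_apply_eq, h₁, eqIso_prefixIncl_nil]
      rw [this, key, h₂, eqIso_prefixIncl_nil]
    exact ⟨_, fun a => key' _, fun b => key' _⟩
  | refl T => exact ⟨.refl _, fun _ => rfl, fun _ => rfl⟩
  | symm d ih =>
    obtain ⟨d', h, h'⟩ := ih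
    refine ⟨.symm d', fun x => ?_, fun y => ?_⟩
    · change d'.iso.symm _ = _
      rw [OrderIso.symm_apply_eq, h]
    · change d'.iso.symm _ = tailIn _ _ (d.iso.symm y)
      rw [OrderIso.symm_apply_eq, h', OrderIso.apply_symm_apply]
  | trans d e ih ih' =>
    obtain ⟨d', h, h'⟩ := ih
    obtain ⟨e', k, k'⟩ := ih'
    refine ⟨.trans d' e', fun x => ?_, fun y => ?_⟩
    · change e'.iso (d'.iso _) = _
      rw [h, k]
    · change e'.iso (d'.iso _) = _
      rw [h', k']; rfl

/-! ### Cutting a tree along an initial segment -/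

theorem Vertex.induction_children {P : Vertex → Prop} (leaf : P .leaf)
    (node : ∀ s l h, (∀ w ∈ l, P w) → P (.ofChildren s l h)) : ∀ v, P v
  | .leaf => leaf
  | .node s c cs => node s (c :: cs) (by simp) (fun w hw =>
      have : sizeOf w < 1 + sizeOf s + sizeOf c + sizeOf cs := by
        have := List.sizeOf_lt_of_mem hw
        simp only [List.cons.sizeOf_spec] at this
        cases s <;> simp <;> omega
      Vertex.induction_children leaf node w)
  termination_by v => sizeOf v

theorem prefixIncl_strictMono (A B : ThreeST) : StrictMono (prefixIncl A B) := fun _ _ h =>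
  (appendIso A B).symm.strictMono (Sum.Lex.inl_lt_inl_iff.2 h)

theorem suffixIncl_strictMono (A B : ThreeST) : StrictMono (suffixIncl A B) := fun _ _ h =>
  (appendIso A B).symm.strictMono (Sum.Lex.inr_lt_inr_iff.2 h)

theorem prefixIncl_lt_suffixIncl (A B : ThreeST) (a : LIN A) (b : LIN B) :
    prefixIncl A B a < suffixIncl A B b :=
  (appendIso A B).symm.strictMono (Sum.Lex.inl_lt_inr _ _)

/-- The set `I` is cut off by a derivation: some derivation from `T` turns `I` into the set of
points on the first `N` branches. -/
def Cuttable (T : ThreeST) (I : Set (LIN T)) : Prop :=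
  ∃ (F : ThreeST) (d : Deriv T F) (N : ℕ), N ≤ F.length ∧ ∀ x, x ∈ I ↔ branchIdx F (d.iso x) < N

theorem Cuttable.of_deriv {T T' : ThreeST} (d : Deriv T T') {I : Set (LIN T)}
    (h : Cuttable T' (d.iso.symm ⁻¹' I)) : Cuttable T I := by
  obtain ⟨F, e, N, hN, hI⟩ := h
  refine ⟨F, d.trans e, N, hN, fun x => ?_⟩
  have := hI (d.iso x)
  rwa [Set.mem_preimage, OrderIso.symm_apply_apply] at this

theorem cuttable_of_forall_notMem {T : ThreeST} {I : Set (LIN T)} (h : ∀ x, x ∉ I) :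
    Cuttable T I :=
  ⟨T, .refl T, 0, Nat.zero_le _, fun x => by simp [h x]⟩

theorem cuttable_of_forall_mem {T : ThreeST} {I : Set (LIN T)} (h : ∀ x, x ∈ I) : Cuttable T I :=
  ⟨T, .refl T, T.length, le_rfl, fun x => by simp [h x, branchIdx_lt]⟩

/-- A cut of a sum falls into one of the two summands. -/
theorem cuttable_cons {v : Vertex} {B : List Vertex} {I : Set (LIN (v :: B))} (hI : IsLowerSet I)
    (h₁ : (∃ a, headIn v B a ∉ I) → Cuttable [v] (prefixIncl [v] B ⁻¹' I))
    (h₂ : (∀ a, headIn v B a ∈ I) → Cuttable B (tailIn v B ⁻¹' I)) : Cuttable (v :: B) I := by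
  by_cases h : ∀ a, headIn v B a ∈ I
  · obtain ⟨F, d, N, hN, hd⟩ := h₂ h
    obtain ⟨d', k, k'⟩ := d.exists_cons v
    refine ⟨_, d', N + 1, by simpa using hN, fun x => ?_⟩
    rcases lin_cons_cases x with ⟨a, rfl⟩ | ⟨b, rfl⟩
    · simp [h, k]
    · have := hd b
      rw [Set.mem_preimage] at this
      simp [k', this]
  · push Not at h
    obtain ⟨a₀, ha₀⟩ := h
    obtain ⟨F, d, N, hN, hd⟩ := h₁ ⟨a₀, ha₀⟩
    obtain ⟨d', k, k'⟩ := d.exists_append B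
    refine ⟨_, d', N, hN.trans (by simp), fun x => ?_⟩
    rcases lin_cons_cases x with ⟨a, rfl⟩ | ⟨b, rfl⟩
    · have h1 := hd (headIn v [] a)
      have h2 := k (headIn v [] a)
      change d'.iso (headIn v B a) = _ at h2
      rw [h2, branchIdx_prefixIncl]
      exact h1
    · have h2 := k' b
      change d'.iso (tailIn v B b) = _ at h2
      rw [h2, branchIdx_suffixIncl]
      exact iff_of_false (fun hb => ha₀ (hI (headIn_lt_tailIn a₀ b).le hb)) (by omega)

theorem isLowerSet_preimage {L M : Type} [LinearOrder L] [LinearOrder M] {f : L → M}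
    (hf : Monotone f) {I : Set M} (hI : IsLowerSet I) : IsLowerSet (f ⁻¹' I) :=
  fun _ _ h h' => hI (hf h) h'

theorem tailIn_mono (v : Vertex) (A : List Vertex) : Monotone (tailIn v A) :=
  fun _ _ h => tailIn_le_tailIn.2 h

/-- Exuding at a `+` vertex brings a given point outside the initial segment one branch closer to
the beginning, so that after finitely many steps the cut falls into an exuded branch. -/
theorem cuttable_pos (N : ℕ) : ∀ (l : List Vertex) (h : l ≠ [])
    (_ : ∀ c ∈ l, ∀ J : Set (LIN [c]), IsLowerSet J → Cuttable [c] J)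
    (I : Set (LIN [.ofChildren .pos l h])) (_ : IsLowerSet I) (n : ℕ) (y : LIN l)
    (_ : copyIn .pos l h n y ∉ I) (_ : n * l.length + branchIdx l y < N),
    Cuttable [.ofChildren .pos l h] I := by
  induction N with
  | zero => intro _ _ _ _ _ _ _ _ h; omega
  | succ N ih =>
    intro l h hl I hI n y hy hN
    obtain ⟨c, cs, rfl⟩ := List.exists_cons_of_ne_nil h
    refine Cuttable.of_deriv (.move (.exudePos c cs)) ?_
    set e := (Deriv.move (Move.exudePos c cs)).iso with he
    have hI' : IsLowerSet (e.symm ⁻¹' I) := isLowerSet_preimage e.symm.monotone hI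
    refine cuttable_cons hI' (fun _ => hl c (by simp) _
      (isLowerSet_preimage (prefixIncl_strictMono _ _).monotone hI')) fun hc => ?_
    have hy' : e (copyIn .pos (c :: cs) h n y) ∉ e.symm ⁻¹' I := by
      rwa [Set.mem_preimage, OrderIso.symm_apply_apply]
    have hl' : ∀ c' ∈ cs ++ [c], ∀ J : Set (LIN [c']), IsLowerSet J → Cuttable [c'] J :=
      fun c' hc' => hl c' (by simpa [or_comm] using hc')
    have step : ∀ (m : ℕ) z, e (copyIn .pos (c :: cs) h n y) =
        tailIn c _ (copyIn .pos (cs ++ [c]) (by simp) m z) →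
        m * (cs ++ [c]).length + branchIdx (cs ++ [c]) z < N →
        Cuttable _ (tailIn c [.ofChildren .pos (cs ++ [c]) (by simp)] ⁻¹' (e.symm ⁻¹' I)) := by
      intro m z hm hlt
      rw [hm] at hy'
      exact ih (cs ++ [c]) (by simp) hl' _
        (isLowerSet_preimage (tailIn_mono _ _) hI') m z hy' hlt
    rcases lin_cons_cases y with ⟨a, rfl⟩ | ⟨b, rfl⟩
    · cases n with
      | zero => exact absurd (hc a) (by rwa [← exudePos_iso_headIn_zero])
      | succ n =>
        refine step n _ (exudePos_iso_headIn_succ c cs n a) ?_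
        simp only [List.length_cons, branchIdx_headIn, branchIdx_suffixIncl, List.length_append,
          List.length_nil, add_mul, zero_add, one_mul] at hN ⊢
        omega
    · refine step n _ (exudePos_iso_tailIn c cs n b) ?_
      simp only [List.length_cons, branchIdx_tailIn, branchIdx_prefixIncl, List.length_append,
        List.length_nil, zero_add] at hN ⊢
      omega

/-- The mirror image of `cuttable_pos`: exuding at a `-` vertex brings a given point of the initial
segment one branch closer to the end. -/
theorem cuttable_neg (N : ℕ) : ∀ (l : List Vertex) (h : l ≠ [])
    (_ : ∀ c ∈ l, ∀ J : Set (LIN [c]), IsLowerSet J → Cuttable [c] J)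
    (I : Set (LIN [.ofChildren .neg l h])) (_ : IsLowerSet I) (n : ℕ) (y : LIN l)
    (_ : copyIn .neg l h (OrderDual.toDual n) y ∈ I) (_ : (n + 1) * l.length < N + branchIdx l y),
    Cuttable [.ofChildren .neg l h] I := by
  induction N with
  | zero =>
    intro l _ _ _ _ n y _ h
    have := branchIdx_lt y
    rw [add_mul] at h
    omega
  | succ N ih =>
    intro l h hl I hI n y hy hN
    obtain ⟨cs, c, rfl⟩ : ∃ cs c, l = cs ++ [c] := ⟨_, _, (List.dropLast_append_getLast h).symm⟩
    refine Cuttable.of_deriv (.move (.exudeNeg cs c)) ?_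
    set e := (Deriv.move (Move.exudeNeg cs c)).iso with he
    have hI' : IsLowerSet (e.symm ⁻¹' I) := isLowerSet_preimage e.symm.monotone hI
    refine cuttable_cons hI' (fun hc => ?_) (fun _ => hl c (by simp) _
      (isLowerSet_preimage (tailIn_mono _ _) hI'))
    have hy' : e (copyIn .neg (cs ++ [c]) h (OrderDual.toDual n) y) ∈ e.symm ⁻¹' I := by
      rwa [Set.mem_preimage, OrderIso.symm_apply_apply]
    have hl' : ∀ c' ∈ c :: cs, ∀ J : Set (LIN [c']), IsLowerSet J → Cuttable [c'] J :=
      fun c' hc' => hl c' (by simpa [or_comm] using hc')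
    have step : ∀ (m : ℕ) z, e (copyIn .neg (cs ++ [c]) h (OrderDual.toDual n) y) =
        prefixIncl _ [c] (copyIn .neg (c :: cs) (by simp) (OrderDual.toDual m) z) →
        (m + 1) * (c :: cs).length < N + branchIdx (c :: cs) z →
        Cuttable _ (prefixIncl [.ofChildren .neg (c :: cs) (by simp)] [c] ⁻¹' (e.symm ⁻¹' I)) := by
      intro m z hm hlt
      rw [hm] at hy'
      exact ih (c :: cs) (by simp) hl' _
        (isLowerSet_preimage (prefixIncl_strictMono _ _).monotone hI') m z hy' hlt
    rcases exists_prefixIncl_or y with ⟨a, rfl⟩ | ⟨b, rfl⟩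
    · refine step n _ (exudeNeg_iso_prefixIncl c cs n a) ?_
      simp only [List.length_cons, branchIdx_tailIn, branchIdx_prefixIncl, List.length_append,
        List.length_nil, add_mul, zero_add, one_mul] at hN ⊢
      omega
    · obtain ⟨b, rfl⟩ | ⟨b, rfl⟩ := lin_cons_cases b
      · cases n with
        | zero =>
          have h0 : e (copyIn .neg (cs ++ [c]) h (OrderDual.toDual (0 : ℕ))
              (suffixIncl cs [c] (headIn c [] b))) = _ :=
            exudeNeg_iso_suffixIncl_zero c cs (headIn c [] b)
          rw [h0] at hy'
          obtain ⟨a, ha⟩ := hc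
          exact absurd (hI' (headIn_lt_tailIn a _).le hy') ha
        | succ n =>
          refine step n _ (exudeNeg_iso_suffixIncl_succ c cs n b) ?_
          simp only [List.length_cons, branchIdx_headIn, branchIdx_suffixIncl, List.length_append,
            List.length_nil, add_mul, zero_add, one_mul] at hN ⊢
          omega
      · exact (b : PEmpty).elim

theorem cuttable_vertex (v : Vertex) : ∀ I : Set (LIN [v]), IsLowerSet I → Cuttable [v] I := by
  induction v using Vertex.induction_children with
  | leaf =>
    intro I _
    by_cases h : ∃ x, x ∈ I
    · obtain ⟨x, hx⟩ := h
      refine cuttable_of_forall_mem fun y => ?_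
      have : x = y := by
        obtain ⟨a, rfl⟩ := (singletonIso .leaf).symm.surjective x
        obtain ⟨b, rfl⟩ := (singletonIso .leaf).symm.surjective y
        exact congrArg _ (Subsingleton.elim (α := PUnit) a b)
      exact this ▸ hx
    · exact cuttable_of_forall_notMem (by simpa using h)
  | node s l h ih =>
    intro I hI
    cases s with
    | pos =>
      by_cases hp : ∃ x, x ∉ I
      · obtain ⟨x, hx⟩ := hp
        obtain ⟨n, y, rfl⟩ := exists_copyIn x
        exact cuttable_pos _ l h ih I hI n y hx (Nat.lt_succ_self _)
      · exact cuttable_of_forall_mem (by simpa using hp)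
    | neg =>
      by_cases hp : ∃ x, x ∈ I
      · obtain ⟨x, hx⟩ := hp
        obtain ⟨n, y, rfl⟩ := exists_copyIn x
        exact cuttable_neg ((OrderDual.ofDual (α := ℕ) n + 1) * l.length + 1) l h ih I hI
          (OrderDual.ofDual (α := ℕ) n) y hx (by omega)
      · exact cuttable_of_forall_notMem (by simpa using hp)

theorem cuttable : ∀ (T : ThreeST) (I : Set (LIN T)), IsLowerSet I → Cuttable T I
  | [], _, _ => cuttable_of_forall_notMem fun x => (x : PEmpty).elim
  | v :: A, _, hI => cuttable_cons hI
      (fun _ => cuttable_vertex v _ (isLowerSet_preimage (prefixIncl_strictMono _ _).monotone hI))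
      (fun _ => cuttable A _ (isLowerSet_preimage (tailIn_mono _ _) hI))

/-- Every initial segment of `LIN(T)` is, up to a derivation, the order of a prefix. -/
theorem exists_deriv_append {T : ThreeST} {I : Set (LIN T)} (hI : IsLowerSet I) :
    ∃ (A R : ThreeST) (d : Deriv T (A ++ R)),
      (∀ a, d.iso.symm (prefixIncl A R a) ∈ I) ∧ ∀ b, d.iso.symm (suffixIncl A R b) ∉ I := by
  obtain ⟨F, d, N, hN, h⟩ := cuttable T I hI
  obtain ⟨A, R, rfl, rfl⟩ : ∃ A R, F = A ++ R ∧ A.length = N :=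
    ⟨F.take N, F.drop N, (List.take_append_drop N F).symm, by simpa using hN⟩
  refine ⟨A, R, d, fun a => ?_, fun b => ?_⟩
  · rw [h, OrderIso.apply_symm_apply, branchIdx_prefixIncl]
    exact branchIdx_lt a
  · rw [h, OrderIso.apply_symm_apply, branchIdx_suffixIncl]
    omega

end ThreeST

/-! ### Depth and embeddings -/

mutual

/-- The number of levels of the tree hanging from a vertex; a leaf has depth `1`. -/
def Vertex.depth : Vertex → ℕ
  | .leaf => 1
  | .node _ c cs => max c.depth (ThreeST.depth cs) + 1

/-- The number of levels of a 3-signed tree below its root. -/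
def ThreeST.depth : List Vertex → ℕ
  | [] => 0
  | v :: vs => max v.depth (ThreeST.depth vs)

end

namespace ThreeST

theorem depth_nil : depth [] = 0 := by rw [depth]

theorem depth_cons (v : Vertex) (A : List Vertex) : depth (v :: A) = max v.depth (depth A) := by
  rw [depth]

theorem depth_leaf : Vertex.depth .leaf = 1 := by rw [Vertex.depth]

theorem depth_ofChildren (s : Sign3) (l : List Vertex) (h : l ≠ []) :
    (Vertex.ofChildren s l h).depth = depth l + 1 := by
  obtain ⟨c, cs, rfl⟩ := List.exists_cons_of_ne_nil h
  rw [Vertex.ofChildren, Vertex.depth, depth_cons]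

theorem depth_le_iff {A : List Vertex} {n : ℕ} : depth A ≤ n ↔ ∀ v ∈ A, v.depth ≤ n := by
  induction A with
  | nil => simp [depth_nil]
  | cons v A ih => simp [depth_cons, ih]

theorem depth_le_of_mem {A : List Vertex} {v : Vertex} (h : v ∈ A) : v.depth ≤ depth A :=
  depth_le_iff.1 le_rfl v h

theorem exists_mem_depth_eq {A : List Vertex} (h : A ≠ []) : ∃ v ∈ A, v.depth = depth A := by
  induction A with
  | nil => exact absurd rfl h
  | cons v A ih =>
    rw [depth_cons]
    rcases le_total (depth A) v.depth with h' | h'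
    · exact ⟨v, by simp, by simp [h']⟩
    · by_cases hA : A = []
      · subst hA
        exact ⟨v, by simp, by simp [depth_nil]⟩
      · obtain ⟨w, hw, e⟩ := ih hA
        exact ⟨w, by simp [hw], by simp [h', e]⟩

theorem depth_flatten_replicate_le (t : ℕ) (l : List Vertex) :
    depth (List.replicate t l).flatten ≤ depth l := by
  rw [depth_le_iff]
  intro v hv
  obtain ⟨l', h, hv⟩ := List.mem_flatten.1 hv
  rw [List.eq_of_mem_replicate h] at hv
  exact depth_le_of_mem hv

theorem depth_pos (v : Vertex) : 0 < v.depth := by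
  cases v <;> rw [Vertex.depth] <;> omega

theorem Vertex.cases_ofChildren (v : Vertex) : v = .leaf ∨ ∃ s l h, v = .ofChildren s l h := by
  cases v with
  | leaf => exact Or.inl rfl
  | node s c cs => exact Or.inr ⟨s, c :: cs, by simp, rfl⟩

theorem nonempty_lin_singleton (v : Vertex) : Nonempty (LIN [v]) := by
  induction v using Vertex.induction_children with
  | leaf => exact ⟨(singletonIso .leaf).symm PUnit.unit⟩
  | node s l h ih =>
    obtain ⟨c, cs, rfl⟩ := List.exists_cons_of_ne_nil h
    obtain ⟨x⟩ := ih c (by simp)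
    have n : s.omega := match s with
      | .pos => (0 : ℕ)
      | .neg => OrderDual.toDual (0 : ℕ)
    exact ⟨copyIn s _ h n (prefixIncl [c] cs x)⟩

theorem nonempty_lin {A : List Vertex} (h : A ≠ []) : Nonempty (LIN A) := by
  obtain ⟨c, cs, rfl⟩ := List.exists_cons_of_ne_nil h
  exact (nonempty_lin_singleton c).map (prefixIncl [c] cs)

theorem exists_lt_lt_omega : ∀ s : Sign3, ∃ i j k : s.omega, i < j ∧ j < k
  | .pos => ⟨(0 : ℕ), (1 : ℕ), (2 : ℕ), Nat.zero_lt_one, Nat.one_lt_two⟩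
  | .neg => ⟨OrderDual.toDual (2 : ℕ), OrderDual.toDual (1 : ℕ), OrderDual.toDual (0 : ℕ),
      Nat.one_lt_two, Nat.zero_lt_one⟩

theorem finite_Icc_omega : ∀ (s : Sign3) (i j : s.omega), (Set.Icc i j).Finite
  | .pos, i, j => Set.finite_Icc (α := ℕ) i j
  | .neg, i, j => Set.finite_Icc (α := ℕᵒᵈ) i j

theorem copyIn_lt_of_lt {s : Sign3} {l : List Vertex} {h : l ≠ []} {n m : s.omega} (hnm : n < m)
    (x y : LIN l) : copyIn s l h n x < copyIn s l h m y :=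
  (branchIso s l h).symm.strictMono (Prod.Lex.toLex_lt_toLex.2 (Or.inl hnm))

theorem copyIn_strictMono (s : Sign3) (l : List Vertex) (h : l ≠ []) (n : s.omega) :
    StrictMono (copyIn s l h n) := fun _ _ hxy =>
  (branchIso s l h).symm.strictMono (Prod.Lex.toLex_lt_toLex.2 (Or.inr ⟨rfl, hxy⟩))

/-- The index of the copy of `LIN l` in which a point lies. -/
def copyIdx (s : Sign3) (l : List Vertex) (h : l ≠ []) (x : LIN [.ofChildren s l h]) : s.omega :=
  (ofLex (branchIso s l h x)).1

@[simp] theorem copyIdx_copyIn (s : Sign3) (l : List Vertex) (h : l ≠ []) (n : s.omega)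
    (x : LIN l) : copyIdx s l h (copyIn s l h n x) = n := by
  rw [copyIdx, branchIso_copyIn]; rfl

theorem copyIdx_mono (s : Sign3) (l : List Vertex) (h : l ≠ []) : Monotone (copyIdx s l h) := by
  intro x y hxy
  obtain ⟨n, x, rfl⟩ := exists_copyIn x
  obtain ⟨m, y, rfl⟩ := exists_copyIn y
  rw [copyIdx_copyIn, copyIdx_copyIn]
  by_contra hlt
  exact absurd hxy (not_le.2 (copyIn_lt_of_lt (not_le.1 hlt) _ _))

theorem exists_embedding_replicate {s : Sign3} {l : List Vertex} {h : l ≠ []} {K : Set s.omega}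
    (hK : K.Finite) {S : Set (LIN [.ofChildren s l h])} (hS : ∀ x ∈ S, copyIdx s l h x ∈ K) :
    ∃ t, Nonempty (S ↪o LIN (List.replicate t l).flatten) := by
  have := hK.fintype
  let e : K ≃o Fin (Fintype.card K) := (Fintype.orderIsoFinOfCardEq K rfl).symm
  let f : S → Fin (Fintype.card K) ×ₗ LIN l := fun x =>
    toLex (e ⟨copyIdx s l h x.1, hS x.1 x.2⟩, (ofLex (branchIso s l h x.1)).2)
  have hf : StrictMono f := by
    intro x y hxy
    have := (branchIso s l h).strictMono (Subtype.coe_lt_coe.2 hxy)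
    rcases Prod.Lex.lt_iff.1 this with h1 | ⟨h1, h2⟩
    · exact Prod.Lex.toLex_lt_toLex.2 (Or.inl (e.strictMono h1))
    · exact Prod.Lex.toLex_lt_toLex.2 (Or.inr ⟨congrArg e (Subtype.ext h1), h2⟩)
  exact ⟨_, ⟨(OrderEmbedding.ofStrictMono f hf).trans
    (replicateIso l _).symm.toOrderEmbedding⟩⟩

/-- The order of a leaf or of a `+` vertex embeds into each of its nonempty final segments. -/
theorem exists_embedding_ge {v : Vertex} (hv : v = .leaf ∨ ∃ l h, v = .ofChildren .pos l h)
    (a : LIN [v]) : ∃ e : LIN [v] ↪o LIN [v], ∀ x, a ≤ e x := by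
  rcases hv with rfl | ⟨l, h, rfl⟩
  · refine ⟨RelEmbedding.refl _, fun x => ?_⟩
    rw [← (singletonIso .leaf).le_iff_le]
    exact (Subsingleton.elim (α := PUnit) _ _).le
  · obtain ⟨n, y, rfl⟩ := exists_copyIn a
    have hsm (k : ℕ) : StrictMono fun p : ℕ ×ₗ LIN l =>
        (toLex ((ofLex p).1 + k + 1, (ofLex p).2) : ℕ ×ₗ LIN l) := by
      intro p q hpq
      rcases Prod.Lex.lt_iff.1 hpq with h1 | ⟨h1, h2⟩
      · exact Prod.Lex.toLex_lt_toLex.2 (Or.inl (by simpa using h1))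
      · exact Prod.Lex.toLex_lt_toLex.2 (Or.inr ⟨by simp [h1], h2⟩)
    refine ⟨((branchIso .pos l h).toOrderEmbedding.trans
      (OrderEmbedding.ofStrictMono _ (hsm n))).trans
      (branchIso .pos l h).symm.toOrderEmbedding, fun x => (copyIn_lt_of_lt ?_ _ _).le⟩
    exact Nat.lt_succ_of_le (Nat.le_add_left _ _)

/-- The order of a leaf or of a `-` vertex embeds into each of its nonempty initial segments. -/
theorem exists_embedding_le {v : Vertex} (hv : v = .leaf ∨ ∃ l h, v = .ofChildren .neg l h)
    (a : LIN [v]) : ∃ e : LIN [v] ↪o LIN [v], ∀ x, e x ≤ a := by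
  rcases hv with rfl | ⟨l, h, rfl⟩
  · refine ⟨RelEmbedding.refl _, fun x => ?_⟩
    rw [← (singletonIso .leaf).le_iff_le]
    exact (Subsingleton.elim (α := PUnit) _ _).le
  · obtain ⟨n, y, rfl⟩ := exists_copyIn a
    have hsm : StrictMono fun p : ℕᵒᵈ ×ₗ LIN l =>
        (toLex (OrderDual.toDual (OrderDual.ofDual (ofLex p).1 + OrderDual.ofDual (α := ℕ) n + 1),
          (ofLex p).2) : ℕᵒᵈ ×ₗ LIN l) := by
      intro p q hpq
      rcases Prod.Lex.lt_iff.1 hpq with h1 | ⟨h1, h2⟩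
      · refine Prod.Lex.toLex_lt_toLex.2 (Or.inl ?_)
        have : OrderDual.ofDual (ofLex q).1 < OrderDual.ofDual (ofLex p).1 := h1
        exact OrderDual.toDual_lt_toDual.2 (by simpa using this)
      · exact Prod.Lex.toLex_lt_toLex.2 (Or.inr ⟨by simp [h1], h2⟩)
    refine ⟨((branchIso .neg l h).toOrderEmbedding.trans (OrderEmbedding.ofStrictMono _ hsm)).trans
      (branchIso .neg l h).symm.toOrderEmbedding, fun x => (copyIn_lt_of_lt ?_ _ _).le⟩
    exact Nat.lt_succ_of_le (Nat.le_add_left (OrderDual.ofDual (α := ℕ) n) _)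

theorem exists_embedding_ge_or_le (v : Vertex) :
    (∀ a, ∃ e : LIN [v] ↪o LIN [v], ∀ x, a ≤ e x) ∨
      ∀ a, ∃ e : LIN [v] ↪o LIN [v], ∀ x, e x ≤ a := by
  rcases Vertex.cases_ofChildren v with h | ⟨_ | _, l, h, rfl⟩
  · exact Or.inl (exists_embedding_ge (Or.inl h))
  · exact Or.inl (exists_embedding_ge (Or.inr ⟨l, h, rfl⟩))
  · exact Or.inr (exists_embedding_le (Or.inr ⟨l, h, rfl⟩))

/-- An order embedding with values in the range of another one factors through it. -/
theorem nonempty_embedding_of_forall_exists {L M K : Type} [LinearOrder L] [LinearOrder M]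
    [LinearOrder K] (e : L ↪o K) (i : M → K) (hi : StrictMono i) (h : ∀ x, ∃ y, e x = i y) :
    Nonempty (L ↪o M) := by
  choose f hf using h
  exact ⟨OrderEmbedding.ofStrictMono f fun x y hxy => hi.lt_iff_lt.1
    (by rw [← hf, ← hf]; exact e.strictMono hxy)⟩

/-- The order of a vertex embeds into a sum only if it embeds into a summand, since it embeds into
each of its nonempty final segments or into each of its nonempty initial segments. -/
theorem embedding_append {v : Vertex} {A B : List Vertex} (e : LIN [v] ↪o LIN (A ++ B)) :
    Nonempty (LIN [v] ↪o LIN A) ∨ Nonempty (LIN [v] ↪o LIN B) := by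
  rcases exists_embedding_ge_or_le v with hv | hv
  · by_cases h : ∃ a b, e a = suffixIncl A B b
    · obtain ⟨a, b, hab⟩ := h
      obtain ⟨i, hi⟩ := hv a
      refine Or.inr (nonempty_embedding_of_forall_exists (i.trans e) _
        (suffixIncl_strictMono A B) fun x => ?_)
      rcases exists_prefixIncl_or (e (i x)) with ⟨c, hc⟩ | h
      · have := e.monotone (hi x)
        rw [hc, hab] at this
        exact absurd this (not_le.2 (prefixIncl_lt_suffixIncl A B c b))
      · exact h
    · push Not at h
      refine Or.inl (nonempty_embedding_of_forall_exists e _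
        (prefixIncl_strictMono A B) fun x => ?_)
      rcases exists_prefixIncl_or (e x) with h' | ⟨b, hb⟩
      · exact h'
      · exact absurd hb (h x b)
  · by_cases h : ∃ a b, e a = prefixIncl A B b
    · obtain ⟨a, b, hab⟩ := h
      obtain ⟨i, hi⟩ := hv a
      refine Or.inl (nonempty_embedding_of_forall_exists (i.trans e) _
        (prefixIncl_strictMono A B) fun x => ?_)
      rcases exists_prefixIncl_or (e (i x)) with h | ⟨c, hc⟩
      · exact h
      · have := e.monotone (hi x)
        rw [hc, hab] at this
        exact absurd this (not_le.2 (prefixIncl_lt_suffixIncl A B b c))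
    · push Not at h
      refine Or.inr (nonempty_embedding_of_forall_exists e _
        (suffixIncl_strictMono A B) fun x => ?_)
      rcases exists_prefixIncl_or (e x) with ⟨b, hb⟩ | h'
      · exact absurd hb (h x b)
      · exact h'

theorem exists_mem_embedding {v : Vertex} : ∀ {B : List Vertex}, (LIN [v] ↪o LIN B) →
    ∃ w ∈ B, Nonempty (LIN [v] ↪o LIN [w])
  | [], e => by
    obtain ⟨x⟩ := nonempty_lin_singleton v
    exact (e x : PEmpty).elim
  | w :: B, e => by
    rcases embedding_append (A := [w]) (B := B) e with h | ⟨⟨e'⟩⟩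
    · exact ⟨w, by simp, h⟩
    · obtain ⟨w', hw', h⟩ := exists_mem_embedding e'
      exact ⟨w', by simp [hw'], h⟩

theorem nonempty_embedding_of_mem {v : Vertex} {A : List Vertex} (h : v ∈ A) :
    Nonempty (LIN [v] ↪o LIN A) := by
  obtain ⟨B, C, rfl⟩ := List.append_of_mem h
  exact ⟨(OrderEmbedding.ofStrictMono _ (prefixIncl_strictMono [v] C)).trans
    (OrderEmbedding.ofStrictMono _ (suffixIncl_strictMono B ([v] ++ C)))⟩

/-- Depth is monotone under embeddings. If `ω^s × l` embeds into `ω^t × m`, then a copy of `LIN l`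
between two others is bounded on both sides and hence embeds into finitely many copies of `LIN m`,
which have the depth of `m`. -/
theorem depth_le_of_embedding_vertex (v : Vertex) : ∀ B : List Vertex, (LIN [v] ↪o LIN B) →
    v.depth ≤ depth B := by
  induction v using Vertex.induction_children with
  | leaf =>
    intro B e
    obtain ⟨w, hw, -⟩ := exists_mem_embedding e
    rw [depth_leaf]
    exact (depth_pos w).trans_le (depth_le_of_mem hw)
  | node s l h ih =>
    intro B e
    obtain ⟨w, hw, ⟨f⟩⟩ := exists_mem_embedding e
    refine le_trans ?_ (depth_le_of_mem hw)
    obtain ⟨i, j, k, hij, hjk⟩ := exists_lt_lt_omega s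
    obtain ⟨z⟩ := nonempty_lin h
    rcases Vertex.cases_ofChildren w with rfl | ⟨t, m, hm, rfl⟩
    · have h1 := f.strictMono (copyIn_lt_of_lt (h := h) hij z z)
      rw [← (singletonIso .leaf).lt_iff_lt] at h1
      exact absurd h1 ((Subsingleton.elim (α := PUnit) _ _).not_lt)
    · rw [depth_ofChildren, depth_ofChildren, add_le_add_iff_right]
      obtain ⟨c, hc, hcd⟩ := exists_mem_depth_eq h
      rw [← hcd]
      let S := Set.Icc (f (copyIn s l h i z)) (f (copyIn s l h k z))
      obtain ⟨T, ⟨g⟩⟩ := exists_embedding_replicate (S := S)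
        (finite_Icc_omega t (copyIdx t m hm (f (copyIn s l h i z)))
          (copyIdx t m hm (f (copyIn s l h k z))))
        (fun x hx => ⟨copyIdx_mono t m hm hx.1, copyIdx_mono t m hm hx.2⟩)
      let u : LIN l → S := fun x => ⟨f (copyIn s l h j x),
        (f.strictMono (copyIn_lt_of_lt hij _ _)).le, (f.strictMono (copyIn_lt_of_lt hjk _ _)).le⟩
      have hu : StrictMono u := fun x y hxy =>
        f.strictMono (copyIn_strictMono s l h j hxy)
      obtain ⟨i₀⟩ := nonempty_embedding_of_mem hc
      exact (ih c hc _ ((i₀.trans (OrderEmbedding.ofStrictMono u hu)).trans g)).trans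
        (depth_flatten_replicate_le _ _)

/-- The depth is monotone under embeddings of the associated orders; in particular it depends on
the order alone. -/
theorem depth_le_of_embedding {A B : ThreeST} (e : LIN A ↪o LIN B) : depth A ≤ depth B := by
  rw [depth_le_iff]
  intro v hv
  obtain ⟨i⟩ := nonempty_embedding_of_mem hv
  exact depth_le_of_embedding_vertex v B (i.trans e)

/-! ### L-equivalence as a congruence -/

theorem LEquiv.refl (A : ThreeST) : LEquiv A A := Relation.EqvGen.refl _

theorem LEquiv.symm {A B : ThreeST} (h : LEquiv A B) : LEquiv B A := Relation.EqvGen.symm _ _ h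

theorem LEquiv.trans {A B C : ThreeST} (h : LEquiv A B) (h' : LEquiv B C) : LEquiv A C :=
  Relation.EqvGen.trans _ _ _ h h'

theorem LEquiv.of_move {A B : ThreeST} (e : Move A B) : LEquiv A B := Relation.EqvGen.rel _ _ ⟨e⟩

theorem LEquiv.nonempty_iso {A B : ThreeST} (h : LEquiv A B) : Nonempty (LIN A ≃o LIN B) :=
  (lEquiv_iff_nonempty_deriv.1 h).map Deriv.iso

theorem LEquiv.append_append (L R : ThreeST) {A B : ThreeST} (h : LEquiv A B) :
    LEquiv (L ++ A ++ R) (L ++ B ++ R) := by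
  induction h with
  | rel _ _ h => exact .of_move (.sibling L R h.some)
  | refl _ => exact .refl _
  | symm _ _ _ ih => exact ih.symm
  | trans _ _ _ _ _ ih ih' => exact ih.trans ih'

theorem LEquiv.append {A A' B B' : ThreeST} (h : LEquiv A A') (h' : LEquiv B B') :
    LEquiv (A ++ B) (A' ++ B') := by
  have h1 := h.append_append [] B
  have h2 := h'.append_append A' []
  simp only [List.nil_append, List.append_nil] at h1 h2
  exact h1.trans h2

theorem eq_nil_of_isEmpty {A : ThreeST} (h : IsEmpty (LIN A)) : A = [] := by
  by_contra hA
  exact (nonempty_lin hA).elim h.elim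

theorem eq_nil_of_iso_nil {A : ThreeST} (e : LIN A ≃o LIN []) : A = [] :=
  eq_nil_of_isEmpty ⟨fun x => (e x : PEmpty).elim⟩

theorem eq_nil_iff_of_iso {A B : ThreeST} (e : LIN A ≃o LIN B) : A = [] ↔ B = [] :=
  ⟨by rintro rfl; exact eq_nil_of_iso_nil e.symm, by rintro rfl; exact eq_nil_of_iso_nil e⟩

theorem LEquiv.under (s : Sign3) {A B : ThreeST} (h : LEquiv A B) (hA : A ≠ []) (hB : B ≠ []) :
    LEquiv [.ofChildren s A hA] [.ofChildren s B hB] := by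
  induction h with
  | rel _ _ h => exact .of_move (.under s hA hB h.some)
  | refl _ => exact .refl _
  | symm _ _ _ ih => exact (ih hB hA).symm
  | trans A C B h _ ih ih' =>
    obtain ⟨e⟩ := LEquiv.nonempty_iso h
    have hC : C ≠ [] := fun hC => hA ((eq_nil_iff_of_iso e).2 hC)
    exact (ih hA hC).trans (ih' hC hB)

theorem ofChildren_congr (s : Sign3) {l l' : List Vertex} (e : l = l') (h : l ≠ []) :
    Vertex.ofChildren s l h = Vertex.ofChildren s l' (e ▸ h) := by subst e; rfl

theorem lEquiv_exude (A : List Vertex) : ∀ (B : List Vertex) (h : A ++ B ≠ []) (h' : B ++ A ≠ []),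
    LEquiv [.ofChildren .pos (A ++ B) h] (A ++ [.ofChildren .pos (B ++ A) h']) := by
  induction A with
  | nil =>
    intro B h h'
    have e : Vertex.ofChildren .pos (B ++ []) h' = .ofChildren .pos B h :=
      ofChildren_congr .pos (List.append_nil B) _
    rw [e]
    exact .refl _
  | cons c A ih =>
    intro B h h'
    have h1 := ih (B ++ [c]) (by simp) (by simp)
    simp only [← List.append_assoc A B [c]] at h1
    rw [ofChildren_congr .pos (List.append_assoc B [c] A)] at h1
    exact (LEquiv.of_move (.exudePos c (A ++ B))).trans ((LEquiv.refl [c]).append h1)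

end ThreeST

/-! ### Reversal -/

/-- The opposite sign. -/
def Sign3.flip : Sign3 → Sign3
  | .pos => .neg
  | .neg => .pos

mutual

/-- The mirror image of the tree hanging from a vertex: all signs are flipped and all lists of
children are reversed. -/
def Vertex.mirror : Vertex → Vertex
  | .leaf => .leaf
  | .node s c cs => .ofChildren s.flip (ThreeST.mirror cs ++ [c.mirror]) (by simp)

/-- The mirror image of a 3-signed tree. -/
def ThreeST.mirror : List Vertex → List Vertex
  | [] => []
  | v :: vs => ThreeST.mirror vs ++ [v.mirror]

end

namespace ThreeST

theorem mirror_leaf : Vertex.mirror .leaf = .leaf := by rw [Vertex.mirror]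

theorem mirror_eq_reverse_map (A : List Vertex) : mirror A = (A.map Vertex.mirror).reverse := by
  induction A with
  | nil => rw [mirror]; rfl
  | cons v A ih => rw [mirror, ih]; simp

theorem mirror_ne_nil {A : List Vertex} (h : A ≠ []) : mirror A ≠ [] := by
  rw [mirror_eq_reverse_map]
  simpa using h

theorem mirror_append (A B : List Vertex) : mirror (A ++ B) = mirror B ++ mirror A := by
  simp [mirror_eq_reverse_map]

theorem mirror_singleton (v : Vertex) : mirror [v] = [v.mirror] := by
  simp [mirror_eq_reverse_map]

theorem mirror_flatten_replicate (m : ℕ) (A : List Vertex) :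
    mirror (List.replicate m A).flatten = (List.replicate m (mirror A)).flatten := by
  induction m with
  | zero => simp [mirror_eq_reverse_map]
  | succ m ih =>
    rw [List.replicate_succ, List.flatten_cons, mirror_append, ih, List.replicate_succ']
    simp

theorem mirror_ofChildren (s : Sign3) (l : List Vertex) (h : l ≠ []) :
    (Vertex.ofChildren s l h).mirror = .ofChildren s.flip (mirror l) (mirror_ne_nil h) := by
  obtain ⟨c, cs, rfl⟩ := List.exists_cons_of_ne_nil h
  rw [Vertex.ofChildren, Vertex.mirror]
  exact ofChildren_congr _ (by rw [mirror]) _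

theorem flip_flip (s : Sign3) : s.flip.flip = s := by cases s <;> rfl

theorem mirror_mirror_vertex (v : Vertex) : v.mirror.mirror = v := by
  induction v using Vertex.induction_children with
  | leaf => simp [mirror_leaf]
  | node s l h ih =>
    rw [mirror_ofChildren, mirror_ofChildren, flip_flip]
    refine ofChildren_congr s ?_ _
    simp only [mirror_eq_reverse_map, List.map_reverse, List.reverse_reverse, List.map_map]
    exact (List.map_congr_left ih).trans (List.map_id' l)

theorem mirror_mirror (A : List Vertex) : mirror (mirror A) = A := by
  simp only [mirror_eq_reverse_map, List.map_reverse, List.reverse_reverse, List.map_map]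
  exact List.map_id'' mirror_mirror_vertex A

theorem depth_mirror_vertex (v : Vertex) : v.mirror.depth = v.depth := by
  induction v using Vertex.induction_children with
  | leaf => rw [mirror_leaf]
  | node s l h ih =>
    rw [mirror_ofChildren, depth_ofChildren, depth_ofChildren]
    congr 1
    refine le_antisymm (depth_le_iff.2 fun w hw => ?_) (depth_le_iff.2 fun w hw => ?_)
    · obtain ⟨u, hu, rfl⟩ : ∃ u ∈ l, u.mirror = w := by
        simpa [mirror_eq_reverse_map] using hw
      rw [ih u hu]
      exact depth_le_of_mem hu
    · rw [← ih w hw]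
      exact depth_le_of_mem (by
        rw [mirror_eq_reverse_map, List.mem_reverse]
        exact List.mem_map_of_mem hw)

theorem LEquiv.mirror_of_move {A B : ThreeST} (e : Move A B) :
    LEquiv (ThreeST.mirror A) (ThreeST.mirror B) := by
  induction e with
  | exudePos c cs =>
    have h1 : mirror (c :: cs) = mirror cs ++ [c.mirror] := by rw [mirror]
    have h2 : mirror (cs ++ [c]) = c.mirror :: mirror cs := by
      rw [mirror_append, mirror_singleton]; rfl
    have h3 : mirror [c, .ofChildren .pos (cs ++ [c]) (by simp)] =
        [.ofChildren .neg (c.mirror :: mirror cs) (by simp), c.mirror] := by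
      rw [← ofChildren_congr .neg h2 (mirror_ne_nil (by simp))]
      simp [mirror_eq_reverse_map, mirror_ofChildren, Sign3.flip]
    rw [h3, mirror_singleton, mirror_ofChildren, ofChildren_congr _ h1]
    exact .of_move (.exudeNeg (mirror cs) c.mirror)
  | exudeNeg cs c =>
    have h1 : mirror (c :: cs) = mirror cs ++ [c.mirror] := by rw [mirror]
    have h2 : mirror (cs ++ [c]) = c.mirror :: mirror cs := by
      rw [mirror_append, mirror_singleton]; rfl
    have h3 : mirror [.ofChildren .neg (c :: cs) (by simp), c] =
        [c.mirror, .ofChildren .pos (mirror cs ++ [c.mirror]) (by simp)] := by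
      rw [← ofChildren_congr .pos h1 (mirror_ne_nil (by simp))]
      simp [mirror_eq_reverse_map, mirror_ofChildren, Sign3.flip]
    rw [h3, mirror_singleton, mirror_ofChildren, ofChildren_congr _ h2]
    exact .of_move (.exudePos c.mirror (mirror cs))
  | repl m s l h h' =>
    rw [mirror_singleton, mirror_singleton, mirror_ofChildren, mirror_ofChildren,
      ofChildren_congr _ (mirror_flatten_replicate m l)]
    exact .of_move (.repl m s.flip (mirror l) _ _)
  | sibling A B e ih =>
    simp only [mirror_append, ← List.append_assoc]
    exact ih.append_append _ _
  | under s h h' e ih =>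
    rw [mirror_singleton, mirror_singleton, mirror_ofChildren, mirror_ofChildren]
    exact ih.under _ _ _

theorem LEquiv.mirror {A B : ThreeST} (h : LEquiv A B) :
    LEquiv (ThreeST.mirror A) (ThreeST.mirror B) := by
  induction h with
  | rel _ _ h => exact .mirror_of_move h.some
  | refl _ => exact .refl _
  | symm _ _ _ ih => exact ih.symm
  | trans _ _ _ _ _ ih ih' => exact ih.trans ih'

/-- The dual of a lexicographic product. -/
def prodLexDual (α β : Type) [LinearOrder α] [LinearOrder β] : (α ×ₗ β)ᵒᵈ ≃o αᵒᵈ ×ₗ βᵒᵈ where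
  toFun p := toLex (OrderDual.toDual (ofLex (OrderDual.ofDual p)).1,
    OrderDual.toDual (ofLex (OrderDual.ofDual p)).2)
  invFun q := OrderDual.toDual (toLex (OrderDual.ofDual (ofLex q).1, OrderDual.ofDual (ofLex q).2))
  left_inv _ := rfl
  right_inv _ := rfl
  map_rel_iff' {p q} := by
    change _ ↔ OrderDual.ofDual q ≤ OrderDual.ofDual p
    rw [Prod.Lex.le_iff, Prod.Lex.le_iff]
    exact or_congr Iff.rfl (and_congr_left' ⟨fun h => (OrderDual.toDual.injective h).symm,
      fun h => congrArg OrderDual.toDual h.symm⟩)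

/-- `(ω^s)* = ω^(-s)`. -/
def omegaDual : (s : Sign3) → (s.omega)ᵒᵈ ≃o s.flip.omega
  | .pos => OrderIso.refl ℕᵒᵈ
  | .neg => (OrderIso.dualDual ℕ).symm

theorem nonempty_iso_mirror_of_forall : ∀ A : ThreeST,
    (∀ v ∈ A, Nonempty ((LIN [v])ᵒᵈ ≃o LIN [v.mirror])) → Nonempty ((LIN A)ᵒᵈ ≃o LIN (mirror A))
  | [], _ => ⟨{
      toFun := fun x : PEmpty => x.elim
      invFun := fun x : PEmpty => x.elim
      left_inv := fun x : PEmpty => x.elim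
      right_inv := fun x : PEmpty => x.elim
      map_rel_iff' := fun {x : PEmpty} => x.elim }⟩
  | v :: A, h => by
    obtain ⟨e⟩ := nonempty_iso_mirror_of_forall A fun w hw => h w (by simp [hw])
    obtain ⟨i⟩ := h v (by simp)
    have i₁ : (LIN (v :: A))ᵒᵈ ≃o (LIN [v] ⊕ₗ LIN A)ᵒᵈ := (appendIso [v] A).dual
    rw [mirror]
    exact ⟨i₁.trans ((OrderIso.sumLexDualAntidistrib _ _).trans
      ((e.sumLexCongr i).trans (appendIso (mirror A) [v.mirror]).symm))⟩

theorem nonempty_iso_mirror_vertex (v : Vertex) : Nonempty ((LIN [v])ᵒᵈ ≃o LIN [v.mirror]) := by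
  induction v using Vertex.induction_children with
  | leaf =>
    rw [mirror_leaf]
    have i : PUnitᵒᵈ ≃o PUnit := {
      toFun := fun _ => ⟨⟩
      invFun := fun _ => OrderDual.toDual ⟨⟩
      left_inv := fun _ => rfl
      right_inv := fun _ => rfl
      map_rel_iff' := by simp }
    exact ⟨(singletonIso .leaf).dual.trans (i.trans (singletonIso .leaf).symm)⟩
  | node s l h ih =>
    obtain ⟨e⟩ := nonempty_iso_mirror_of_forall l ih
    rw [mirror_ofChildren]
    exact ⟨(branchIso s l h).dual.trans ((prodLexDual _ _).trans
      ((Prod.Lex.prodLexCongr (omegaDual s) e).trans (branchIso _ _ _).symm))⟩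

theorem nonempty_iso_mirror (A : ThreeST) : Nonempty ((LIN A)ᵒᵈ ≃o LIN (mirror A)) :=
  nonempty_iso_mirror_of_forall A fun v _ => nonempty_iso_mirror_vertex v

/-! ### Subsets represented by trees -/

/-- The subset `s` of a linear order is isomorphic to `LIN(A)`. -/
def Rep {M : Type} [LinearOrder M] (s : Set M) (A : ThreeST) : Prop :=
  ∃ f : LIN A → M, StrictMono f ∧ Set.range f = s

section Rep

variable {M M' : Type} [LinearOrder M] [LinearOrder M']

theorem Rep.nonempty_iso {s : Set M} {A B : ThreeST} (hA : Rep s A) (hB : Rep s B) :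
    Nonempty (LIN A ≃o LIN B) := by
  obtain ⟨f, hf, rfl⟩ := hA
  obtain ⟨g, hg, e⟩ := hB
  exact ⟨(hf.orderIso f).trans ((OrderIso.setCongr _ _ e.symm).trans (hg.orderIso g).symm)⟩

theorem Rep.image {s : Set M} {A : ThreeST} (h : Rep s A) {g : M → M'} (hg : StrictMono g) :
    Rep (g '' s) A := by
  obtain ⟨f, hf, rfl⟩ := h
  exact ⟨g ∘ f, hg.comp hf, Set.range_comp g f⟩

theorem Rep.union {s t : Set M} {A B : ThreeST} (hA : Rep s A) (hB : Rep t B)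
    (h : ∀ a ∈ s, ∀ b ∈ t, a < b) : Rep (s ∪ t) (A ++ B) := by
  obtain ⟨f, hf, rfl⟩ := hA
  obtain ⟨g, hg, rfl⟩ := hB
  let k : LIN A ⊕ₗ LIN B → M := fun x => Sum.elim f g (ofLex x)
  have hk : StrictMono k := by
    rintro (a | a) (b | b) hab
    · exact hf (Sum.Lex.inl_lt_inl_iff.1 hab)
    · exact h _ ⟨a, rfl⟩ _ ⟨b, rfl⟩
    · exact absurd hab Sum.Lex.not_inr_lt_inl
    · exact hg (Sum.Lex.inr_lt_inr_iff.1 hab)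
  refine ⟨k ∘ appendIso A B, hk.comp (appendIso A B).strictMono, ?_⟩
  rw [(appendIso A B).surjective.range_comp]
  exact (ofLex.surjective.range_comp (Sum.elim f g)).trans (Set.Sum.elim_range f g)

theorem isEmpty_lin_nil : IsEmpty (LIN []) := inferInstanceAs (IsEmpty PEmpty)

theorem rep_empty {s : Set M} (h : s = ∅) : Rep s [] :=
  have := isEmpty_lin_nil
  ⟨isEmptyElim, fun x => isEmptyElim x, by rw [h, Set.range_eq_empty]⟩

/-- The concatenation of the `k` trees `y N, …, y (N + k - 1)`. -/
def seg (y : ℕ → ThreeST) (N k : ℕ) : ThreeST := ((List.range k).map fun i => y (N + i)).flatten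

theorem seg_zero (y : ℕ → ThreeST) (N : ℕ) : seg y N 0 = [] := rfl

theorem seg_succ (y : ℕ → ThreeST) (N k : ℕ) : seg y N (k + 1) = seg y N k ++ y (N + k) := by
  simp [seg, List.range_succ]

theorem seg_add (y : ℕ → ThreeST) (N k m : ℕ) :
    seg y N (k + m) = seg y N k ++ seg y (N + k) m := by
  induction m with
  | zero => simp [seg_zero]
  | succ m ih => rw [← add_assoc, seg_succ, seg_succ, ih, List.append_assoc, add_assoc]

theorem seg_one (y : ℕ → ThreeST) (N : ℕ) : seg y N 1 = y N := by
  simp [seg]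

theorem seg_congr {y z : ℕ → ThreeST} {N N' k : ℕ} (h : ∀ i < k, y (N + i) = z (N' + i)) :
    seg y N k = seg z N' k := by
  rw [seg, seg, List.map_congr_left fun i hi => h i (List.mem_range.1 hi)]

/-- The linear order `M` is the `ω`-indexed sum of the orders `LIN(y i)`, where `idx` gives the
index of the summand in which a point lies. -/
structure Fibred (M : Type) [LinearOrder M] (y : ℕ → ThreeST) (idx : M → ℕ) : Prop where
  mono : Monotone idx
  rep : ∀ i, Rep {p | idx p = i} (y i)

theorem Fibred.rep_seg {y : ℕ → ThreeST} {idx : M → ℕ} (h : Fibred M y idx) (N k : ℕ) :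
    Rep {p | N ≤ idx p ∧ idx p < N + k} (seg y N k) := by
  induction k with
  | zero => exact rep_empty (Set.eq_empty_of_forall_notMem fun p hp => by
      have := hp.1; have := hp.2; omega)
  | succ k ih =>
    rw [seg_succ]
    have : {p | N ≤ idx p ∧ idx p < N + (k + 1)} =
        {p | N ≤ idx p ∧ idx p < N + k} ∪ {p | idx p = N + k} := by
      ext p
      simp only [Set.mem_ofPred_eq, Set.mem_union]
      omega
    rw [this]
    refine ih.union (h.rep _) fun a ha b hb => lt_of_not_ge fun hba => ?_
    have h1 := h.mono hba
    have h2 := ha.2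
    have h3 : idx b = N + k := hb
    omega

/-! ### Cuts that separate points by large intervals -/

/-- The set `s` embeds into the order of a tree of depth less than `r`. -/
def Small (r : ℕ) (s : Set M) : Prop := ∃ B, depth B < r ∧ Nonempty (s ↪o LIN B)

theorem Small.of_embedding {r : ℕ} {s : Set M} {t : Set M'} (h : Small r t) (e : s ↪o t) :
    Small r s := by
  obtain ⟨B, hB, ⟨i⟩⟩ := h
  exact ⟨B, hB, ⟨e.trans i⟩⟩

theorem not_small_of_embedding {v : Vertex} {s : Set M} (f : LIN [v] → M) (hf : StrictMono f)
    (h : ∀ x, f x ∈ s) : ¬ Small v.depth s := by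
  rintro ⟨B, hB, ⟨i⟩⟩
  have hg : StrictMono fun x => (⟨f x, h x⟩ : s) := fun _ _ hxy => hf hxy
  exact absurd (depth_le_of_embedding_vertex v B ((OrderEmbedding.ofStrictMono _ hg).trans i))
    (not_le.2 hB)

/-- Two points of the order of one vertex lie in finitely many copies of the sum over the
children. -/
theorem small_Icc_of_lt {v : Vertex} {a b : LIN [v]} (hab : a < b) :
    Small v.depth (Set.Icc a b) := by
  rcases Vertex.cases_ofChildren v with rfl | ⟨s, l, h, rfl⟩
  · rw [← (singletonIso .leaf).lt_iff_lt] at hab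
    exact absurd hab ((Subsingleton.elim (α := PUnit) _ _).not_lt)
  · obtain ⟨T, hT⟩ := exists_embedding_replicate (S := Set.Icc a b)
      (finite_Icc_omega s (copyIdx s l h a) (copyIdx s l h b))
      (fun x hx => ⟨copyIdx_mono s l h hx.1, copyIdx_mono s l h hx.2⟩)
    refine ⟨_, ?_, hT⟩
    rw [depth_ofChildren]
    exact Nat.lt_succ_of_le (depth_flatten_replicate_le T l)

theorem Fibred.small_Icc {y : ℕ → ThreeST} {idx : M → ℕ} (h : Fibred M y idx) {v : Vertex} {i : ℕ}
    (hv : y i = [v]) {a b : M} (hab : a < b) (ha : idx a = i) (hb : idx b = i) :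
    Small v.depth (Set.Icc a b) := by
  have hr := h.rep i
  rw [hv] at hr
  obtain ⟨f, hf, hr⟩ := hr
  have hmem : ∀ p, idx p = i → ∃ x, f x = p := fun p hp => by
    have : p ∈ Set.range f := by rw [hr]; exact hp
    exact this
  obtain ⟨a, rfl⟩ := hmem a ha
  obtain ⟨b, rfl⟩ := hmem b hb
  obtain ⟨e⟩ : Nonempty (Set.Icc (f a) (f b) ↪o Set.Icc a b) := by
    refine nonempty_embedding_of_forall_exists (OrderEmbedding.subtype _) (fun x => f x.1)
      (fun _ _ hxy => hf hxy) fun x => ?_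
    obtain ⟨z, hz⟩ := hmem x.1 (le_antisymm (hb ▸ h.mono x.2.2) (ha ▸ h.mono x.2.1))
    refine ⟨⟨z, ?_, ?_⟩, hz.symm⟩
    · rw [← hf.le_iff_le, hz]; exact x.2.1
    · rw [← hf.le_iff_le, hz]; exact x.2.2
  exact (small_Icc_of_lt (hf.lt_iff_lt.1 hab)).of_embedding e

/-- The cut after a leaf or a `+` vertex only separates points by large intervals. -/
theorem Fibred.not_small_of_after {y : ℕ → ThreeST} {idx : M → ℕ} (h : Fibred M y idx) {v : Vertex}
    {i : ℕ} (hi : y i = [v]) (hv : v = .leaf ∨ ∃ l h, v = .ofChildren .pos l h) {a b : M}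
    (ha : idx a ≤ i) (hb : i < idx b) : ¬ Small v.depth (Set.Icc a b) := by
  have hr := h.rep i
  rw [hi] at hr
  obtain ⟨f, hf, hr⟩ := hr
  have hmem : ∀ x, idx (f x) = i := fun x => by
    have : f x ∈ {p | idx p = i} := hr ▸ Set.mem_range_self x
    exact this
  have hfb : ∀ x, f x ≤ b := fun x => le_of_not_gt fun hlt => by
    have := h.mono hlt.le
    rw [hmem x] at this
    omega
  rcases ha.lt_or_eq with ha | ha
  · refine not_small_of_embedding f hf fun x => ⟨le_of_not_gt fun hlt => ?_, hfb x⟩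
    have := h.mono hlt.le
    rw [hmem x] at this
    omega
  · obtain ⟨a, rfl⟩ : a ∈ Set.range f := by rw [hr]; exact ha
    obtain ⟨e, he⟩ := exists_embedding_ge hv a
    exact not_small_of_embedding (f ∘ e) (hf.comp e.strictMono)
      fun x => ⟨hf.monotone (he x), hfb _⟩

/-- The cut before a leaf or a `-` vertex only separates points by large intervals. -/
theorem Fibred.not_small_of_before {y : ℕ → ThreeST} {idx : M → ℕ} (h : Fibred M y idx)
    {v : Vertex} {i : ℕ} (hi : y i = [v]) (hv : v = .leaf ∨ ∃ l h, v = .ofChildren .neg l h)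
    {a b : M} (ha : idx a < i) (hb : i ≤ idx b) : ¬ Small v.depth (Set.Icc a b) := by
  have hr := h.rep i
  rw [hi] at hr
  obtain ⟨f, hf, hr⟩ := hr
  have hmem : ∀ x, idx (f x) = i := fun x => by
    have : f x ∈ {p | idx p = i} := hr ▸ Set.mem_range_self x
    exact this
  have hfa : ∀ x, a ≤ f x := fun x => le_of_not_gt fun hlt => by
    have := h.mono hlt.le
    rw [hmem x] at this
    omega
  rcases hb.lt_or_eq with hb | hb
  · refine not_small_of_embedding f hf fun x => ⟨hfa x, le_of_not_gt fun hlt => ?_⟩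
    have := h.mono hlt.le
    rw [hmem x] at this
    omega
  · obtain ⟨b, rfl⟩ : b ∈ Set.range f := by rw [hr]; exact hb.symm
    obtain ⟨e, he⟩ := exists_embedding_le hv b
    exact not_small_of_embedding (f ∘ e) (hf.comp e.strictMono)
      fun x => ⟨hfa _, hf.monotone (he x)⟩

/-- An isomorphism carries a cut that only separates points by large intervals to a cut between
two summands, if the summands `y' i` with `i > 0` are given by vertices of depth at most `r`, whose
intervals are small. The point `p` keeps the image of the cut out of the summand `y' 0`. -/
theorem Fibred.exists_image_eq {y' : ℕ → ThreeST} {idx : M → ℕ} {idx' : M' → ℕ}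
    (h' : Fibred M' y' idx') {r : ℕ}
    (hy' : ∀ i, ∃ v, y' (i + 1) = [v] ∧ v.depth ≤ r) (f : M ≃o M') (hidx : Monotone idx) {n : ℕ}
    (hn : ∀ a b, idx a < n → n ≤ idx b → ¬ Small r (Set.Icc a b))
    {p : M} (hp : idx p < n) (hp' : 0 < idx' (f p)) {q : M} (hq : n ≤ idx q) :
    ∃ n', 0 < n' ∧ ∀ x, idx x < n ↔ idx' (f x) < n' := by
  classical
  have hex : ∃ k, ∃ x, n ≤ idx x ∧ idx' (f x) = k := ⟨_, q, hq, rfl⟩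
  have hlt : ∀ {x z}, idx x < n → n ≤ idx z → f x < f z := fun {x z} hx hz =>
    f.strictMono (lt_of_not_ge fun hzx => by have := hidx hzx; omega)
  obtain ⟨b, hb, hbn⟩ := Nat.find_spec hex
  have hpos : 0 < Nat.find hex := by
    rw [← hbn]
    exact hp'.trans_le (h'.mono (hlt hp hb).le)
  refine ⟨Nat.find hex, hpos, fun x => ⟨fun hx => ?_, fun hx => ?_⟩⟩
  · refine lt_of_not_ge fun hge => ?_
    have hxb := hlt hx hb
    have heq : idx' (f x) = Nat.find hex := le_antisymm (hbn ▸ h'.mono hxb.le) hge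
    obtain ⟨j, hj⟩ : ∃ j, Nat.find hex = j + 1 := ⟨_, (Nat.succ_pred_eq_of_pos hpos).symm⟩
    obtain ⟨v, hv, hvr⟩ := hy' j
    obtain ⟨B, hB, hs⟩ := h'.small_Icc hv hxb (heq.trans hj) (hbn.trans hj)
    have hs' : Small r (Set.Icc (f x) (f b)) := ⟨B, hB.trans_le hvr, hs⟩
    refine hn x b hx hb (hs'.of_embedding (OrderEmbedding.ofStrictMono
      (fun z => ⟨f z.1, f.monotone z.2.1, f.monotone z.2.2⟩) fun _ _ hzw => f.strictMono hzw))
  · refine lt_of_not_ge fun hge => ?_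
    exact absurd hx (not_lt.2 (Nat.find_min' hex ⟨x, hge, rfl⟩))

end Rep

/-! ### The periodic decomposition at a `+` vertex -/

theorem rep_branchIdx : ∀ (A : List Vertex) (i : ℕ) (hi : i < A.length),
    Rep {x : LIN A | branchIdx A x = i} [A[i]]
  | [], _, hi => absurd hi (Nat.not_lt_zero _)
  | v :: A, 0, _ => by
    refine ⟨prefixIncl [v] A, prefixIncl_strictMono _ _, Set.ext fun x => ⟨?_, fun hx => ?_⟩⟩
    · rintro ⟨a, rfl⟩
      exact (branchIdx_prefixIncl [v] A a).trans (Nat.lt_one_iff.1 (branchIdx_lt a))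
    · rcases lin_cons_cases x with ⟨a, rfl⟩ | ⟨b, rfl⟩
      · exact ⟨headIn v [] a, rfl⟩
      · exact absurd hx (by simp)
  | v :: A, i + 1, hi => by
    obtain ⟨f, hf, hr⟩ := rep_branchIdx A i (Nat.lt_of_succ_lt_succ hi)
    refine ⟨fun x => suffixIncl [v] A (f x), (suffixIncl_strictMono [v] A).comp hf,
      Set.ext fun x => ⟨?_, fun hx => ?_⟩⟩
    · rintro ⟨a, rfl⟩
      have h1 : f a ∈ {x : LIN A | branchIdx A x = i} := hr ▸ Set.mem_range_self a
      have h2 := branchIdx_suffixIncl [v] A (f a)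
      rw [Set.mem_ofPred_eq] at h1
      rw [h1] at h2
      exact h2.trans (Nat.add_comm _ _)
    · rcases lin_cons_cases x with ⟨a, rfl⟩ | ⟨b, rfl⟩
      · exact absurd hx (by simp)
      · have h1 : b ∈ Set.range f := by rw [hr]; simpa using hx
        obtain ⟨a, rfl⟩ := h1
        exact ⟨a, rfl⟩

/-- The sequence of trees with one branch that repeats the branches of `l` periodically. -/
def cycle (l : List Vertex) (i : ℕ) : ThreeST := l[i % l.length]?.toList

theorem cycle_eq {l : List Vertex} (h : l ≠ []) (i : ℕ) :
    ∃ hi : i % l.length < l.length, cycle l i = [l[i % l.length]] :=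
  ⟨Nat.mod_lt _ (List.length_pos_iff.2 h), by simp [cycle, Nat.mod_lt _ (List.length_pos_iff.2 h)]⟩

theorem cycle_congr {l : List Vertex} {i j : ℕ} (h : i % l.length = j % l.length) :
    cycle l i = cycle l j := by
  rw [cycle, cycle, h]

theorem seg_cycle_zero (l : List Vertex) : seg (cycle l) 0 l.length = l := by
  have : (List.range l.length).map (fun i => cycle l (0 + i)) = l.map fun v => [v] := by
    refine List.ext_getElem (by simp) fun i h₁ h₂ => ?_
    have hi : i < l.length := by simpa using h₂
    simp [cycle, Nat.mod_eq_of_lt hi, hi]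
  rw [seg, this]
  rw [← List.flatMap_def, List.flatMap_singleton']

theorem seg_cycle_add_mul (l : List Vertex) (N t k : ℕ) :
    seg (cycle l) (N + t * l.length) k = seg (cycle l) N k := by
  refine seg_congr fun i _ => cycle_congr ?_
  rw [show N + t * l.length + i = N + i + t * l.length by ring, Nat.add_mul_mod_self_right]

theorem seg_cycle_mul (l : List Vertex) (N t : ℕ) :
    seg (cycle l) N (t * l.length) = (List.replicate t (seg (cycle l) N l.length)).flatten := by
  induction t with
  | zero => simp [seg_zero]
  | succ t ih =>
    rw [List.replicate_succ', List.flatten_concat, ← ih, Nat.succ_mul, seg_add, seg_cycle_add_mul]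

theorem seg_cycle_ne_nil {l : List Vertex} (h : l ≠ []) (N : ℕ) {k : ℕ} (hk : 0 < k) :
    seg (cycle l) N k ≠ [] := by
  obtain ⟨k, rfl⟩ : ∃ j, k = j + 1 := ⟨_, (Nat.succ_pred_eq_of_pos hk).symm⟩
  obtain ⟨_, e⟩ := cycle_eq h (N + k)
  rw [seg_succ, e]
  simp

theorem depth_seg_cycle_le (l : List Vertex) (N k : ℕ) : depth (seg (cycle l) N k) ≤ depth l := by
  rw [depth_le_iff]
  intro v hv
  obtain ⟨A, hA, hv⟩ := List.mem_flatten.1 hv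
  obtain ⟨i, -, rfl⟩ := List.mem_map.1 hA
  exact depth_le_of_mem (List.mem_of_getElem? (Option.mem_toList.1 hv))

/-- Exuding the first `N` branches of `ω × l` and replicating the rotated list of children. -/
theorem lEquiv_seg_cycle {l : List Vertex} (h : l ≠ []) (N : ℕ) {t : ℕ} (ht : 0 < t)
    (h' : seg (cycle l) N (t * l.length) ≠ []) :
    LEquiv [.ofChildren .pos l h]
      (seg (cycle l) 0 N ++ [.ofChildren .pos (seg (cycle l) N (t * l.length)) h']) := by
  have hlen : 0 < l.length := List.length_pos_iff.2 h
  have hne := fun N => seg_cycle_ne_nil h N hlen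
  have step : ∀ N, LEquiv [.ofChildren .pos l h]
      (seg (cycle l) 0 N ++ [.ofChildren .pos (seg (cycle l) N l.length) (hne N)]) := by
    intro N
    induction N with
    | zero =>
      rw [ofChildren_congr .pos (seg_cycle_zero l)]
      exact .refl _
    | succ N ih =>
      obtain ⟨k, hk⟩ : ∃ k, l.length = k + 1 := ⟨_, (Nat.succ_pred_eq_of_pos hlen).symm⟩
      have e₁ : seg (cycle l) N l.length = cycle l N ++ seg (cycle l) (N + 1) k := by
        rw [hk, add_comm, seg_add, seg_one]
      have e₂ : seg (cycle l) (N + 1) l.length = seg (cycle l) (N + 1) k ++ cycle l N := by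
        rw [hk, seg_succ]
        congr 1
        refine cycle_congr ?_
        rw [show N + 1 + k = N + l.length by omega, Nat.add_mod_right]
      refine ih.trans ?_
      rw [seg_succ, List.append_assoc, ofChildren_congr .pos e₁, ofChildren_congr .pos e₂, zero_add]
      exact (LEquiv.refl _).append (lEquiv_exude _ _ _ _)
  refine (step N).trans ((LEquiv.refl _).append ?_)
  have : NeZero t := ⟨ht.ne'⟩
  rw [ofChildren_congr .pos (seg_cycle_mul l N t) h']
  exact .of_move (.repl t .pos _ _ _)

/-- The index of the child in `ω × l`, counted along all copies of `l`. -/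
def childIdx (l : List Vertex) (h : l ≠ []) (x : LIN [.ofChildren .pos l h]) : ℕ :=
  let p : ℕ ×ₗ LIN l := branchIso .pos l h x
  (ofLex p).1 * l.length + branchIdx l (ofLex p).2

theorem childIdx_copyIn (l : List Vertex) (h : l ≠ []) (n : ℕ) (x : LIN l) :
    childIdx l h (copyIn .pos l h n x) = n * l.length + branchIdx l x :=
  congrArg (fun p : ℕ ×ₗ LIN l => (ofLex p).1 * l.length + branchIdx l (ofLex p).2)
    (branchIso_copyIn .pos l h n x)

theorem exists_copyIn_pos {l : List Vertex} {h : l ≠ []} (x : LIN [.ofChildren .pos l h]) :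
    ∃ (n : ℕ) (y : LIN l), x = copyIn .pos l h n y := exists_copyIn x

theorem fibred_node (l : List Vertex) (h : l ≠ []) :
    Fibred (LIN [.ofChildren .pos l h]) (cycle l) (childIdx l h) where
  mono x y hxy := by
    obtain ⟨n, x, rfl⟩ := exists_copyIn_pos x
    obtain ⟨m, y, rfl⟩ := exists_copyIn_pos y
    rw [childIdx_copyIn, childIdx_copyIn]
    have hnm : n ≤ m := le_of_not_gt fun hlt =>
      absurd hxy (not_le.2 (copyIn_lt_of_lt (s := .pos) hlt _ _))
    rcases Nat.lt_or_eq_of_le hnm with hlt | heq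
    · have h1 := branchIdx_lt x
      have h2 := Nat.mul_le_mul_right l.length hlt
      rw [Nat.succ_mul] at h2
      omega
    · subst heq
      have := branchIdx_mono l ((copyIn_strictMono .pos l h n).le_iff_le.1 hxy)
      omega
  rep i := by
    obtain ⟨hi, e⟩ := cycle_eq h i
    rw [e]
    obtain ⟨f, hf, hr⟩ := rep_branchIdx l _ hi
    refine ⟨fun x => copyIn .pos l h (i / l.length : ℕ) (f x),
      (copyIn_strictMono .pos l h _).comp hf, Set.ext fun x => ⟨?_, fun hx => ?_⟩⟩
    · rintro ⟨a, rfl⟩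
      have h1 : f a ∈ {x : LIN l | branchIdx l x = i % l.length} := hr ▸ Set.mem_range_self a
      rw [Set.mem_ofPred_eq] at h1
      rw [Set.mem_ofPred_eq, childIdx_copyIn, h1, mul_comm]
      exact Nat.div_add_mod i l.length
    · obtain ⟨n, x, rfl⟩ := exists_copyIn_pos x
      rw [Set.mem_ofPred_eq, childIdx_copyIn] at hx
      have hb := branchIdx_lt x
      have h1 : i % l.length = branchIdx l x := by
        rw [← hx, Nat.add_comm, Nat.add_mul_mod_self_right, Nat.mod_eq_of_lt hb]
      have h2 : i / l.length = n := by
        rw [← hx, Nat.add_comm, Nat.add_mul_div_right _ _ (by omega), Nat.div_eq_of_lt hb,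
          Nat.zero_add]
      obtain ⟨a, rfl⟩ : x ∈ Set.range f := by rw [hr]; exact h1.symm
      exact ⟨a, by rw [h2]⟩

/-- The decomposition of `S + ω × l` into `S` and the copies of the children. -/
def seqAfter (S : ThreeST) (l : List Vertex) : ℕ → ThreeST
  | 0 => S
  | i + 1 => cycle l i

/-- The index of the summand of `S + ω × l` in which a point lies. -/
def idxAfter (S : ThreeST) (l : List Vertex) (h : l ≠ [])
    (x : LIN (S ++ [.ofChildren .pos l h])) : ℕ :=
  match ofLex (appendIso S [.ofChildren .pos l h] x) with
  | Sum.inl _ => 0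
  | Sum.inr y => childIdx l h y + 1

theorem idxAfter_prefixIncl (S : ThreeST) (l : List Vertex) (h : l ≠ []) (a : LIN S) :
    idxAfter S l h (prefixIncl S _ a) = 0 := by
  rw [idxAfter, appendIso_prefixIncl]; rfl

theorem idxAfter_suffixIncl (S : ThreeST) (l : List Vertex) (h : l ≠ [])
    (b : LIN [.ofChildren .pos l h]) :
    idxAfter S l h (suffixIncl S _ b) = childIdx l h b + 1 := by
  rw [idxAfter, appendIso_suffixIncl]; rfl

theorem fibred_after (S : ThreeST) (l : List Vertex) (h : l ≠ []) :
    Fibred (LIN (S ++ [.ofChildren .pos l h])) (seqAfter S l) (idxAfter S l h) where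
  mono x y hxy := by
    rcases exists_prefixIncl_or x with ⟨a, rfl⟩ | ⟨a, rfl⟩ <;>
      rcases exists_prefixIncl_or y with ⟨b, rfl⟩ | ⟨b, rfl⟩
    · simp [idxAfter_prefixIncl]
    · simp [idxAfter_prefixIncl]
    · exact absurd hxy (not_le.2 (prefixIncl_lt_suffixIncl _ _ _ _))
    · rw [idxAfter_suffixIncl, idxAfter_suffixIncl, add_le_add_iff_right]
      exact (fibred_node l h).mono ((suffixIncl_strictMono _ _).le_iff_le.1 hxy)
  rep i := by
    cases i with
    | zero =>
      refine ⟨prefixIncl S _, prefixIncl_strictMono _ _, Set.ext fun x => ⟨?_, fun hx => ?_⟩⟩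
      · rintro ⟨a, rfl⟩
        exact idxAfter_prefixIncl S l h a
      · rcases exists_prefixIncl_or x with ⟨a, rfl⟩ | ⟨b, rfl⟩
        · exact ⟨a, rfl⟩
        · rw [Set.mem_ofPred_eq, idxAfter_suffixIncl] at hx
          exact absurd hx (Nat.succ_ne_zero _)
    | succ i =>
      have := ((fibred_node l h).rep i).image (suffixIncl_strictMono S [.ofChildren .pos l h])
      refine (congrArg (Rep · (cycle l i)) (Set.ext fun x => ⟨?_, fun hx => ?_⟩)).mp this
      · rintro ⟨b, hb, rfl⟩
        rw [Set.mem_ofPred_eq, idxAfter_suffixIncl]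
        exact congrArg (· + 1) hb
      · rcases exists_prefixIncl_or x with ⟨a, rfl⟩ | ⟨b, rfl⟩
        · rw [Set.mem_ofPred_eq, idxAfter_prefixIncl] at hx
          exact absurd hx.symm (Nat.succ_ne_zero _)
        · rw [Set.mem_ofPred_eq, idxAfter_suffixIncl] at hx
          exact ⟨b, Nat.succ_injective hx, rfl⟩

theorem seg_seqAfter_succ (S : ThreeST) (l : List Vertex) (N k : ℕ) :
    seg (seqAfter S l) (N + 1) k = seg (cycle l) N k :=
  seg_congr fun i _ => by rw [Nat.add_right_comm]; rfl

theorem seg_seqAfter_zero (S : ThreeST) (l : List Vertex) (k : ℕ) :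
    seg (seqAfter S l) 0 (k + 1) = S ++ seg (cycle l) 0 k := by
  rw [add_comm, seg_add, seg_one, seg_seqAfter_succ S l 0]; rfl

/-! ### Isomorphic orders come from L-equivalent trees -/

/-- If `ω × l` is isomorphic to a sum whose last summand is given by the vertex `w`, then `w` has
sign `+`: otherwise the sum would embed into a proper initial segment of itself, hence into
finitely many copies of `LIN l`. -/
theorem exists_eq_ofChildren_pos {l : List Vertex} {h : l ≠ []} {S : ThreeST} {w : Vertex}
    (f : LIN [.ofChildren .pos l h] ≃o LIN (S ++ [w])) :
    ∃ l' h', w = .ofChildren .pos l' h' ∧ depth l' ≤ depth l := by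
  have hd : depth (S ++ [w]) ≤ depth l + 1 := by
    refine (depth_le_of_embedding f.symm.toOrderEmbedding).trans (depth_le_iff.2 fun v hv => ?_)
    rw [List.mem_singleton.1 hv, depth_ofChildren]
  have hd' : ¬ depth (S ++ [w]) ≤ depth l := fun hle => by
    have := depth_le_of_mem (List.mem_singleton.2 rfl : Vertex.ofChildren .pos l h ∈ [_])
    have := this.trans ((depth_le_of_embedding f.toOrderEmbedding).trans hle)
    rw [depth_ofChildren] at this
    omega
  have key : ¬ (w = .leaf ∨ ∃ l h, w = .ofChildren .neg l h) := by
    intro hw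
    obtain ⟨p⟩ := nonempty_lin_singleton w
    obtain ⟨e, he⟩ := exists_embedding_le hw p
    -- `g` fixes `S` and compresses the last summand below the point `p`.
    let g : LIN (S ++ [w]) ↪o LIN (S ++ [w]) :=
      ((appendIso S [w]).toOrderEmbedding.trans (OrderEmbedding.ofStrictMono
        (fun x : LIN S ⊕ₗ LIN [w] => toLex (Sum.map id e (ofLex x)))
        (by
          rintro (a | a) (b | b) hab
          · exact hab
          · exact Sum.Lex.inl_lt_inr _ _
          · exact absurd hab Sum.Lex.not_inr_lt_inl
          · exact Sum.Lex.inr_lt_inr_iff.2 (e.strictMono (Sum.Lex.inr_lt_inr_iff.1 hab))))).trans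
        (appendIso S [w]).symm.toOrderEmbedding
    have hg : ∀ x, g x ≤ suffixIncl S [w] p := by
      intro x
      obtain ⟨z, rfl⟩ := (appendIso S [w]).symm.surjective x
      change (appendIso S [w]).symm (toLex (Sum.map id e (ofLex
        (appendIso S [w] ((appendIso S [w]).symm z))))) ≤ _
      rw [OrderIso.apply_symm_apply]
      rcases z with a | b
      · exact (prefixIncl_lt_suffixIncl S [w] a p).le
      · exact (suffixIncl_strictMono S [w]).monotone (he b)
    let q := f.symm (suffixIncl S [w] p)
    obtain ⟨T, ⟨i⟩⟩ := exists_embedding_replicate (l := l) (h := h) (S := Set.Iic q)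
      (K := Set.Iic (copyIdx .pos l h q)) (Set.finite_Iic (α := ℕ) _)
      (fun x hx => copyIdx_mono _ _ _ hx)
    let u : LIN (S ++ [w]) → Set.Iic q := fun x => ⟨f.symm (g x), f.symm.monotone (hg x)⟩
    have hu : StrictMono u := fun x y hxy => f.symm.strictMono (g.strictMono hxy)
    exact hd' ((depth_le_of_embedding ((OrderEmbedding.ofStrictMono u hu).trans i)).trans
      (depth_flatten_replicate_le _ _))
  rcases Vertex.cases_ofChildren w with hw | ⟨_ | _, l', h', rfl⟩
  · exact absurd (Or.inl hw) key
  · refine ⟨l', h', rfl, ?_⟩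
    have := (depth_le_of_mem (v := .ofChildren .pos l' h')
      (A := S ++ [.ofChildren .pos l' h']) (by simp)).trans hd
    rw [depth_ofChildren] at this
    omega
  · exact absurd (Or.inr ⟨l', h', rfl⟩) key

/-- In `ω × l` there are periodically recurring cuts that only separate points by large intervals:
those after a fixed child of maximal depth if it is a leaf or has sign `+`, and those before it if
it has sign `-`. -/
theorem exists_periodic_cuts (l : List Vertex) (h : l ≠ []) :
    ∃ n, 0 < n ∧ ∀ k a b, childIdx l h a < n + k * l.length → n + k * l.length ≤ childIdx l h b →
      ¬ Small (depth l) (Set.Icc a b) := by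
  obtain ⟨v, hv, hd⟩ := exists_mem_depth_eq h
  obtain ⟨i, hi, rfl⟩ := List.mem_iff_getElem.1 hv
  have hlen : 0 < l.length := List.length_pos_iff.2 h
  have hc : ∀ k, cycle l (i + k * l.length) = [l[i]] := fun k => by
    have hmod : (i + k * l.length) % l.length = i := by
      rw [Nat.add_mul_mod_self_right, Nat.mod_eq_of_lt hi]
    simp [cycle, hmod, hi]
  rw [← hd]
  rcases Vertex.cases_ofChildren l[i] with hw | ⟨_ | _, m, hm, hw⟩
  · exact ⟨i + 1, by omega, fun k a b ha hb => (fibred_node l h).not_small_of_after (hc k)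
      (Or.inl hw) (by omega) (by omega)⟩
  · exact ⟨i + 1, by omega, fun k a b ha hb => (fibred_node l h).not_small_of_after (hc k)
      (Or.inr ⟨m, hm, hw⟩) (by omega) (by omega)⟩
  · refine ⟨i + l.length, by omega, fun k a b ha hb => ?_⟩
    have e : i + l.length + k * l.length = i + (k + 1) * l.length := by ring
    rw [e] at ha hb
    exact (fibred_node l h).not_small_of_before (hc (k + 1)) (Or.inr ⟨m, hm, hw⟩) ha hb

theorem exists_lt_mod_eq (n : ℕ → ℕ) {m : ℕ} (hm : 0 < m) : ∃ i j, i < j ∧ n i % m = n j % m := by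
  have : NeZero m := ⟨hm.ne'⟩
  obtain ⟨i, j, hij, e⟩ := Finite.exists_ne_map_eq_of_infinite fun k => Fin.ofNat m (n k)
  have e' : n i % m = n j % m := congrArg Fin.val e
  rcases hij.lt_or_gt with h | h
  · exact ⟨i, j, h, e'⟩
  · exact ⟨j, i, h, e'.symm⟩

/-- The periodicity argument: an isomorphism `ω × l ≅ S + ω × l'` matches infinitely many
periodically recurring cuts on the left with cuts between children on the right. Two of the latter
are at the same place of the period, so up to L-equivalence both sides have the same head and the
same period. -/
theorem lEquiv_of_iso_pos_append {l l' : List Vertex} {h : l ≠ []} {h' : l' ≠ []} {S : ThreeST}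
    (hd : depth l' ≤ depth l)
    (ih : ∀ A B : ThreeST, depth A ≤ depth l → (LIN A ≃o LIN B) → LEquiv A B)
    (f : LIN [.ofChildren .pos l h] ≃o LIN (S ++ [.ofChildren .pos l' h'])) :
    LEquiv [.ofChildren .pos l h] (S ++ [.ofChildren .pos l' h']) := by
  have hlen : 0 < l.length := List.length_pos_iff.2 h
  have hlen' : 0 < l'.length := List.length_pos_iff.2 h'
  have hF := fibred_node l h
  have hF' := fibred_after S l' h'
  obtain ⟨n₀, hn₀, hcut⟩ := exists_periodic_cuts l h
  -- The cuts are taken so late that their images lie beyond `S`.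
  obtain ⟨p'⟩ := nonempty_lin_singleton (.ofChildren .pos l' h')
  obtain ⟨p, hp⟩ := f.surjective (suffixIncl S _ p')
  obtain ⟨z⟩ := nonempty_lin h
  let N : ℕ → ℕ := fun k => n₀ + (childIdx l h p + k) * l.length
  have hN : ∀ k, ∃ n', 0 < n' ∧ ∀ x, childIdx l h x < N k ↔ idxAfter S l' h' (f x) < n' := by
    intro k
    refine hF'.exists_image_eq (fun i => ?_) f hF.mono (hcut _) (p := p) ?_ ?_
      (q := copyIn .pos l h (N k) z) ?_
    · obtain ⟨hi, e⟩ := cycle_eq h' i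
      exact ⟨_, e, (depth_le_of_mem (List.getElem_mem hi)).trans hd⟩
    · have : childIdx l h p + k ≤ (childIdx l h p + k) * l.length := Nat.le_mul_of_pos_right _ hlen
      change childIdx l h p < n₀ + (childIdx l h p + k) * l.length
      omega
    · rw [hp, idxAfter_suffixIncl]
      exact Nat.succ_pos _
    · rw [childIdx_copyIn]
      exact (Nat.le_mul_of_pos_right _ hlen).trans (Nat.le_add_right _ _)
  choose n' hpos hn' using hN
  -- Two of the images are at the same place of the period of `ω × l'`.
  obtain ⟨i, j, hij, hmod⟩ := exists_lt_mod_eq n' hlen'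
  obtain ⟨t, ht, hNj⟩ : ∃ t, 0 < t ∧ N j = N i + t * l.length := by
    refine ⟨j - i, by omega, ?_⟩
    obtain ⟨d, rfl⟩ := Nat.exists_eq_add_of_lt hij
    have : i + d + 1 - i = d + 1 := by omega
    rw [this]
    ring
  have hlt : n' i < n' j := by
    obtain ⟨_, e⟩ := cycle_eq h (N i)
    have hr := hF.rep (N i)
    rw [e] at hr
    obtain ⟨g, -, hg⟩ := hr
    obtain ⟨y⟩ := nonempty_lin_singleton l[N i % l.length]
    have hmem : childIdx l h (g y) = N i := by
      have : g y ∈ {x | childIdx l h x = N i} := hg ▸ Set.mem_range_self y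
      exact this
    have h1 := (hn' i (g y)).not.1 (by omega)
    have h2 := (hn' j (g y)).1 (by rw [hmem, hNj]; exact Nat.lt_add_of_pos_right (by positivity))
    omega
  obtain ⟨t', ht', hnj⟩ : ∃ t', 0 < t' ∧ n' j = n' i + t' * l'.length := by
    obtain ⟨t', e⟩ := (Nat.modEq_iff_dvd' hlt.le).1 hmod
    refine ⟨t', Nat.pos_of_ne_zero fun h0 => ?_, ?_⟩
    · rw [h0, mul_zero] at e
      omega
    · rw [mul_comm] at e
      omega
  obtain ⟨a, ha⟩ : ∃ a, n' i = a + 1 := ⟨_, (Nat.succ_pred_eq_of_pos (hpos i)).symm⟩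
  -- The heads before the first cut are isomorphic, ...
  obtain ⟨e₁⟩ : Nonempty (LIN (seg (cycle l) 0 (N i)) ≃o LIN (S ++ seg (cycle l') 0 a)) := by
    rw [← seg_seqAfter_zero, ← ha]
    have h1 := (hF.rep_seg 0 (N i)).image f.strictMono
    have h2 := hF'.rep_seg 0 (n' i)
    have : f '' {x | 0 ≤ childIdx l h x ∧ childIdx l h x < 0 + N i} =
        {x | 0 ≤ idxAfter S l' h' x ∧ idxAfter S l' h' x < 0 + n' i} := by
      ext x
      obtain ⟨x, rfl⟩ := f.surjective x
      rw [f.injective.mem_set_image]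
      simp [hn']
    rw [this] at h1
    exact h1.nonempty_iso h2
  -- ... and so are the segments between the two cuts, which are whole numbers of periods.
  obtain ⟨e₂⟩ : Nonempty (LIN (seg (cycle l) (N i) (t * l.length)) ≃o
      LIN (seg (cycle l') a (t' * l'.length))) := by
    rw [← seg_seqAfter_succ S l' a, ← ha]
    have h1 := (hF.rep_seg (N i) (t * l.length)).image f.strictMono
    have h2 := hF'.rep_seg (n' i) (t' * l'.length)
    have : f '' {x | N i ≤ childIdx l h x ∧ childIdx l h x < N i + t * l.length} =
        {x | n' i ≤ idxAfter S l' h' x ∧ idxAfter S l' h' x < n' i + t' * l'.length} := by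
      ext x
      obtain ⟨x, rfl⟩ := f.surjective x
      rw [f.injective.mem_set_image, ← hNj, ← hnj]
      simp only [Set.mem_ofPred_eq, hn', ← not_lt]
    rw [this] at h1
    exact h1.nonempty_iso h2
  have hne := seg_cycle_ne_nil h (N i) (Nat.mul_pos ht hlen)
  have hne' := seg_cycle_ne_nil h' a (Nat.mul_pos ht' hlen')
  have q₁ := lEquiv_seg_cycle h (N i) ht hne
  have q₂ := (LEquiv.refl S).append (lEquiv_seg_cycle h' a ht' hne')
  rw [← List.append_assoc] at q₂
  exact q₁.trans (((ih _ _ (depth_seg_cycle_le _ _ _) e₁).append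
    ((ih _ _ (depth_seg_cycle_le _ _ _) e₂).under .pos hne hne')).trans q₂.symm)

theorem lEquiv_of_iso_pos {l : List Vertex} {h : l ≠ []} {A : ThreeST}
    (ih : ∀ A B : ThreeST, depth A ≤ depth l → (LIN A ≃o LIN B) → LEquiv A B)
    (f : LIN [.ofChildren .pos l h] ≃o LIN A) : LEquiv [.ofChildren .pos l h] A := by
  have hA : A ≠ [] := fun hA => by simpa using (eq_nil_iff_of_iso f).2 hA
  obtain ⟨S, w, rfl⟩ : ∃ S w, A = S ++ [w] := ⟨_, _, (List.dropLast_append_getLast hA).symm⟩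
  obtain ⟨l', h', rfl, hd⟩ := exists_eq_ofChildren_pos f
  exact lEquiv_of_iso_pos_append hd ih f

theorem lEquiv_of_iso_neg {l : List Vertex} {h : l ≠ []} {A : ThreeST}
    (ih : ∀ A B : ThreeST, depth A ≤ depth l → (LIN A ≃o LIN B) → LEquiv A B)
    (f : LIN [.ofChildren .neg l h] ≃o LIN A) : LEquiv [.ofChildren .neg l h] A := by
  obtain ⟨i⟩ := nonempty_iso_mirror [.ofChildren .neg l h]
  obtain ⟨j⟩ := nonempty_iso_mirror A
  have e : mirror [.ofChildren .neg l h] = [.ofChildren .pos (mirror l) (mirror_ne_nil h)] := by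
    rw [mirror_singleton, mirror_ofChildren]; rfl
  have k : LIN (mirror [.ofChildren .neg l h]) ≃o LIN (mirror A) := i.symm.trans (f.dual.trans j)
  rw [e] at k
  have hd : depth (mirror l) ≤ depth l := depth_le_iff.2 fun w hw => by
    obtain ⟨u, hu, rfl⟩ : ∃ u ∈ l, u.mirror = w := by simpa [mirror_eq_reverse_map] using hw
    rw [depth_mirror_vertex]
    exact depth_le_of_mem hu
  have := (lEquiv_of_iso_pos (fun A B hA => ih A B (hA.trans hd)) k).mirror
  rw [← e, mirror_mirror, mirror_mirror] at this
  exact this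

theorem eq_leaf_of_iso {A : ThreeST} (f : LIN [.leaf] ≃o LIN A) : A = [.leaf] := by
  have hsub : ∀ x y : LIN A, ¬ x < y := fun x y hxy => by
    have := ((f.symm.trans (singletonIso .leaf)).strictMono hxy).ne
    exact this (Subsingleton.elim (α := PUnit) _ _)
  have hA : A ≠ [] := fun hA => by simpa using (eq_nil_iff_of_iso f).2 hA
  obtain ⟨w, B, rfl⟩ := List.exists_cons_of_ne_nil hA
  obtain ⟨x⟩ := nonempty_lin_singleton w
  have hB : B = [] := eq_nil_of_isEmpty ⟨fun y => hsub _ _ (prefixIncl_lt_suffixIncl [w] B x y)⟩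
  subst hB
  rcases Vertex.cases_ofChildren w with rfl | ⟨s, l, h, rfl⟩
  · rfl
  · obtain ⟨i, j, _, hij, -⟩ := exists_lt_lt_omega s
    obtain ⟨z⟩ := nonempty_lin h
    exact absurd (copyIn_lt_of_lt hij z z) (hsub _ _)

/-- An isomorphism from a sum splits, up to a derivation, into isomorphisms of the summands. -/
theorem exists_lEquiv_append_of_iso {A B T : ThreeST} (f : LIN (A ++ B) ≃o LIN T) :
    ∃ C D, LEquiv T (C ++ D) ∧ Nonempty (LIN A ≃o LIN C) ∧ Nonempty (LIN B ≃o LIN D) := by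
  have hI : IsLowerSet (Set.range fun a => f (prefixIncl A B a)) := by
    rintro x y hxy ⟨a, rfl⟩
    obtain ⟨z, rfl⟩ := f.surjective y
    rcases exists_prefixIncl_or z with ⟨c, rfl⟩ | ⟨c, rfl⟩
    · exact ⟨c, rfl⟩
    · exact absurd (f.le_iff_le.1 hxy) (not_le.2 (prefixIncl_lt_suffixIncl A B a c))
  obtain ⟨C, D, d, hC, hD⟩ := exists_deriv_append hI
  have hr₁ : Rep (Set.range fun a => f (prefixIncl A B a)) A :=
    ⟨_, f.strictMono.comp (prefixIncl_strictMono A B), rfl⟩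
  have hr₂ : Rep (Set.range fun a => f (prefixIncl A B a))ᶜ B := by
    refine ⟨_, f.strictMono.comp (suffixIncl_strictMono A B), Set.ext fun x => ⟨?_, fun hx => ?_⟩⟩
    · rintro ⟨b, rfl⟩ ⟨a, hab⟩
      exact (prefixIncl_lt_suffixIncl A B a b).ne (f.injective hab)
    · obtain ⟨z, rfl⟩ := f.surjective x
      rcases exists_prefixIncl_or z with ⟨c, rfl⟩ | ⟨c, rfl⟩
      · exact absurd ⟨c, rfl⟩ hx
      · exact ⟨c, rfl⟩
  have hr₃ : Rep (Set.range fun a => f (prefixIncl A B a)) C := by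
    refine ⟨_, d.iso.symm.strictMono.comp (prefixIncl_strictMono C D),
      Set.ext fun x => ⟨?_, fun hx => ?_⟩⟩
    · rintro ⟨c, rfl⟩
      exact hC c
    · obtain ⟨z, rfl⟩ := d.iso.symm.surjective x
      rcases exists_prefixIncl_or z with ⟨c, rfl⟩ | ⟨c, rfl⟩
      · exact ⟨c, rfl⟩
      · exact absurd hx (hD c)
  have hr₄ : Rep (Set.range fun a => f (prefixIncl A B a))ᶜ D := by
    refine ⟨_, d.iso.symm.strictMono.comp (suffixIncl_strictMono C D),
      Set.ext fun x => ⟨?_, fun hx => ?_⟩⟩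
    · rintro ⟨c, rfl⟩
      exact hD c
    · obtain ⟨z, rfl⟩ := d.iso.symm.surjective x
      rcases exists_prefixIncl_or z with ⟨c, rfl⟩ | ⟨c, rfl⟩
      · exact absurd (hC c) hx
      · exact ⟨c, rfl⟩
  exact ⟨C, D, lEquiv_iff_nonempty_deriv.2 ⟨d⟩, hr₁.nonempty_iso hr₃, hr₂.nonempty_iso hr₄⟩

theorem lEquiv_of_iso_of_forall_vertex : ∀ {A B : ThreeST},
    (∀ v ∈ A, ∀ C : ThreeST, (LIN [v] ≃o LIN C) → LEquiv [v] C) → (LIN A ≃o LIN B) → LEquiv A B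
  | [], B, _, f => by
    rw [eq_nil_of_iso_nil f.symm]
    exact .refl _
  | v :: A, B, h, f => by
    obtain ⟨C, D, hB, ⟨e₁⟩, ⟨e₂⟩⟩ := exists_lEquiv_append_of_iso (A := [v]) (B := A) f
    exact ((h v (by simp) C e₁).append (lEquiv_of_iso_of_forall_vertex
      (fun w hw => h w (by simp [hw])) e₂)).trans hB.symm

/-- Trees with isomorphic orders are L-equivalent, by induction on the depth. -/
theorem lEquiv_of_iso {A B : ThreeST} (f : LIN A ≃o LIN B) : LEquiv A B := by
  have key : ∀ r, ∀ A B : ThreeST, depth A ≤ r → (LIN A ≃o LIN B) → LEquiv A B := by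
    intro r
    induction r with
    | zero =>
      intro A B hA f
      refine lEquiv_of_iso_of_forall_vertex (fun v hv => ?_) f
      exact absurd ((depth_le_of_mem hv).trans hA) (not_le.2 (depth_pos v))
    | succ r ih =>
      intro A B hA f
      refine lEquiv_of_iso_of_forall_vertex (fun v hv C g => ?_) f
      have hvr := (depth_le_of_mem hv).trans hA
      rcases Vertex.cases_ofChildren v with rfl | ⟨_ | _, l, h, rfl⟩
      · rw [eq_leaf_of_iso g]
        exact .refl _
      · rw [depth_ofChildren] at hvr
        exact lEquiv_of_iso_pos (fun A B hA => ih A B (by omega)) g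
      · rw [depth_ofChildren] at hvr
        exact lEquiv_of_iso_neg (fun A B hA => ih A B (by omega)) g
  exact key _ A B le_rfl f

/-! ### Prefix and suffix embeddings -/

theorem exists_iso_of_range_eq {L M K : Type} [LinearOrder L] [LinearOrder M] [LinearOrder K]
    (f : L ↪o K) {i : M → K} (hi : StrictMono i) (h : Set.range i = Set.range f) :
    ∃ g : L ≃o M, ∀ x, i (g x) = f x := by
  refine ⟨(f.strictMono.orderIso f).trans
    ((OrderIso.setCongr _ _ h.symm).trans (hi.orderIso i).symm), fun x => ?_⟩
  exact congrArg Subtype.val ((hi.orderIso i).apply_symm_apply _)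

theorem exists_of_isPrefixEmbedding {T T' : ThreeST} {f : LIN T ↪o LIN T'}
    (hf : IsPrefixEmbedding f) :
    ∃ U R : ThreeST, LEquiv T U ∧ LEquiv T' (U.join R) ∧
      (∃ (g : LIN T ≃o LIN U) (d : Deriv (U.join R) T'),
        ∀ x : LIN U, d.iso (prefixIncl U R x) = f (g.symm x)) ∧
      (∀ g : LIN T ≃o LIN U, ∃ h : LIN (U.join R) ≃o LIN T',
        ∀ x : LIN U, h (prefixIncl U R x) = f (g.symm x)) := by
  obtain ⟨U, R, d, hU, hR⟩ := exists_deriv_append hf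
  have hi : StrictMono fun x => d.iso.symm (prefixIncl U R x) :=
    d.iso.symm.strictMono.comp (prefixIncl_strictMono U R)
  have hr : Set.range (fun x => d.iso.symm (prefixIncl U R x)) = Set.range f := by
    refine Set.ext fun x => ⟨?_, fun hx => ?_⟩
    · rintro ⟨a, rfl⟩
      exact hU a
    · obtain ⟨z, rfl⟩ := d.iso.symm.surjective x
      rcases exists_prefixIncl_or z with ⟨c, rfl⟩ | ⟨c, rfl⟩
      · exact ⟨c, rfl⟩
      · exact absurd hx (hR c)
  obtain ⟨g, hg⟩ := exists_iso_of_range_eq f hi hr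
  refine ⟨U, R, lEquiv_of_iso g, lEquiv_iff_nonempty_deriv.2 ⟨d⟩, ⟨g, d.symm, fun x => ?_⟩,
    fun g' => ?_⟩
  · have := hg (g.symm x)
    rwa [OrderIso.apply_symm_apply] at this
  · refine ⟨(appendIso U R).trans ((((g'.symm.trans g).sumLexCongr (OrderIso.refl _)).trans
      (appendIso U R).symm).trans d.iso.symm), fun x => ?_⟩
    have h1 := congrArg (fun p => d.iso.symm ((appendIso U R).symm
      ((g'.symm.trans g).sumLexCongr (OrderIso.refl (LIN R)) p))) (appendIso_prefixIncl U R x)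
    exact h1.trans (hg (g'.symm x))

theorem exists_of_isSuffixEmbedding {T T' : ThreeST} {f : LIN T ↪o LIN T'}
    (hf : IsSuffixEmbedding f) :
    ∃ U R : ThreeST, LEquiv T U ∧ LEquiv T' (R.join U) ∧
      (∃ (g : LIN T ≃o LIN U) (d : Deriv (R.join U) T'),
        ∀ x : LIN U, d.iso (suffixIncl R U x) = f (g.symm x)) ∧
      (∀ g : LIN T ≃o LIN U, ∃ h : LIN (R.join U) ≃o LIN T',
        ∀ x : LIN U, h (suffixIncl R U x) = f (g.symm x)) := by
  obtain ⟨R, U, d, hR, hU⟩ := exists_deriv_append (IsUpperSet.compl hf)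
  have hi : StrictMono fun x => d.iso.symm (suffixIncl R U x) :=
    d.iso.symm.strictMono.comp (suffixIncl_strictMono R U)
  have hr : Set.range (fun x => d.iso.symm (suffixIncl R U x)) = Set.range f := by
    refine Set.ext fun x => ⟨?_, fun hx => ?_⟩
    · rintro ⟨a, rfl⟩
      exact not_not.1 (hU a)
    · obtain ⟨z, rfl⟩ := d.iso.symm.surjective x
      rcases exists_prefixIncl_or z with ⟨c, rfl⟩ | ⟨c, rfl⟩
      · exact absurd hx (hR c)
      · exact ⟨c, rfl⟩
  obtain ⟨g, hg⟩ := exists_iso_of_range_eq f hi hr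
  refine ⟨U, R, lEquiv_of_iso g, lEquiv_iff_nonempty_deriv.2 ⟨d⟩, ⟨g, d.symm, fun x => ?_⟩,
    fun g' => ?_⟩
  · have := hg (g.symm x)
    rwa [OrderIso.apply_symm_apply] at this
  · refine ⟨(appendIso R U).trans ((((OrderIso.refl _).sumLexCongr (g'.symm.trans g)).trans
      (appendIso R U).symm).trans d.iso.symm), fun x => ?_⟩
    have h1 := congrArg (fun p => d.iso.symm ((appendIso R U).symm
      ((OrderIso.refl (LIN R)).sumLexCongr (g'.symm.trans g) p))) (appendIso_suffixIncl R U x)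
    exact h1.trans (hg (g'.symm x))

end ThreeST

theorem mainTheorem2 (T T' : ThreeST) (f : ThreeST.LIN T ↪o ThreeST.LIN T') :
    (ThreeST.IsPrefixEmbedding f →
      ∃ U R : ThreeST, ThreeST.LEquiv T U ∧ ThreeST.LEquiv T' (U.join R) ∧
        (∃ (g : ThreeST.LIN T ≃o ThreeST.LIN U) (d : ThreeST.Deriv (U.join R) T'),
          ∀ x : ThreeST.LIN U, d.iso (ThreeST.prefixIncl U R x) = f (g.symm x)) ∧
        (∀ g : ThreeST.LIN T ≃o ThreeST.LIN U,
          ∃ h : ThreeST.LIN (U.join R) ≃o ThreeST.LIN T',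
            ∀ x : ThreeST.LIN U, h (ThreeST.prefixIncl U R x) = f (g.symm x))) ∧
    (ThreeST.IsSuffixEmbedding f →
      ∃ U R : ThreeST, ThreeST.LEquiv T U ∧ ThreeST.LEquiv T' (R.join U) ∧
        (∃ (g : ThreeST.LIN T ≃o ThreeST.LIN U) (d : ThreeST.Deriv (R.join U) T'),
          ∀ x : ThreeST.LIN U, d.iso (ThreeST.suffixIncl R U x) = f (g.symm x)) ∧
        (∀ g : ThreeST.LIN T ≃o ThreeST.LIN U,
          ∃ h : ThreeST.LIN (R.join U) ≃o ThreeST.LIN T',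
            ∀ x : ThreeST.LIN U, h (ThreeST.suffixIncl R U x) = f (g.symm x))) :=
  ⟨ThreeST.exists_of_isPrefixEmbedding, ThreeST.exists_of_isSuffixEmbedding⟩
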